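/- **Setting.** Let $X$ be a real Banach space with dual $X^*$, $\Omega\subset X$ open, $Y$ a real vector space and $H\subset Y$ an infinite-dimensional subspace. For each $x\in\Omega$ let $Q(x,\cdot)$ be a positive definite quadratic form on $Y$ and $G(x,\cdot)$ a quadratic form on $H$, with associated symmetric bilinear forms $B(x,\cdot,\cdot)$ and $\Gamma(x,\cdot,\cdot)$, and assume that $H$ is dense in $Y$ for $Q(x,\cdot)^{1/2}$. Put $\mathcal R(x,u)=G(x,u)/Q(x,u)$ for $0\ne u\in H$. A subscript $x$ (as in $Q_x,G_x,B_x,\Gamma_x,\mathcal R_x$) denotes the Fréchet derivative in the variable $x$, an element of $X^*$, which carries its norm topology. Assume that for every $x\in\Omega$ there are a neighborhood $V\subset\Omega$ of $x$ and a bounded function $\theta:V\to(0,\infty)$ such that, with $N(x',\cdot)=[G(x',\cdot)+\theta(x')Q(x',\cdot)]^{1/2}$: * for each $x'\in V$, $N(x',\cdot)$ is a Hilbert (complete) norm on $H$, and there is $C\ge 1$ with $C^{-1}N(x',\cdot)\le N(x,\cdot)\le C\,N(x',\cdot)$ on $H$ for all $x'\in V$; * if $x_n\in V$, $x_n\to x$,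 $u_n\in H$ and $\sup_n N(x_n,u_n)<\infty$, then there is $u\in H$ such that, along a subsequence, $Q(x_n,u_n-u)\to0$ and $\Gamma(x_n,u_n,h)\to\Gamma(x,u,h)$ for all $h\in H$; * $Q(\cdot,u)$ and $G(\cdot,v)$ are Fréchet differentiable at $x$ for all $u\in Y$, $v\in H$; * if $x_n\in V$, $x_n\to x$, $u_n,u\in Y$ and $Q(x_n,u_n-u)\to 0$, then $Q(x_n,u_n)\to Q(x,u)$ and $Q_x(x_n,u_n)\to Q_x(x,u)$; if $x_n\in V$, $x_n\to x$, $v_n,v\in H$ and $N(x_n,v_n-v)\to0$, then $G(x_n,v_n)\to G(x,v)$ and $G_x(x_n,v_n)\to G_x(x,v)$; * there is $C_0>0$ such that $\|B_x(x',u,v)\|_{X^*}\le C_0N(x',u)N(x',v)$ and $\|\Gamma_x(x',u,v)\|_{X^*}\le C_0N(x',u)N(x',v)$ for all $x'\in V$ and $u,v\in H$. For $k\ge1$ let $$\lambda_k(x)=\inf_{E\subset H,\ \dim E=k}\ \sup_{u\in E,\ Q(x,u)=1}\mathcal R(x,u),\qquad E_k(x)=\{u\in H:\ \Gamma(x,u,v)=\lambda_k(x)B(x,u,v)\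 \ \forall v\in H\}.$$ Let $\mathbf U_N(x)$ be the set of $Q(x,\cdot)$-orthonormal families $(u_1,\dots,u_N)$ with $u_k\in E_k(x)$ for every $k$. The *cluster* of $k$ at $x$ is $\{j\ge1:\lambda_j(x)=\lambda_k(x)\}$. For $f:\Omega\to\mathbb R$ and $h\in X$ let $f^\circ_+(x,h)$ and $f^\circ_-(x,h)$ be the $\limsup$ and the $\liminf$ of $\frac{f(y+th)-f(y)}{t}$ as $y\to x$, $t\downarrow0$. The Clarke sub- and superdifferential of $f$ at $x$ are $$\partial_C^-f(x)=\{\zeta\in X^*:\langle\zeta,h\rangle\le f^\circ_+(x,h)\ \forall h\in X\},\qquad \partial_C^+f(x)=\{\zeta\in X^*:\langle\zeta,h\rangle\ge f^\circ_-(x,h)\ \forall h\in X\}.$$ **Proposition.** Let $N\ge1$, let $F:\mathbb R^N\to\mathbb R$ be of class $\mathcal C^1$, and set $\mathfrak F(x)=F(\lambda_1(x),\dots,\lambda_N(x))$, $d_k(x)=\partial_kF(\lambda_1(x),\dots,\lambda_N(x))$ for $1\le k\le N$, $d_k(x)=0$ for $k>N$, and $\lambda_0(x)=-\infty$. For $x\in\Omega$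 set $$C'_N(x)=\mathrm{co}\Big\{\sum_{k=1}^Nd_k(x)\,\mathcal R_x(x,u_k)\ :\ (u_k)\in\mathbf U_N(x)\Big\}.$$ Then for every $x\in\Omega$: 1. $\partial_C^-\mathfrak F(x)\subset C'_N(x)$ and $\partial_C^+\mathfrak F(x)\subset C'_N(x)$. 2. If $\lambda_N(x)<\lambda_{N+1}(x)$ and $k\mapsto d_k(x)$ is constant on each cluster at $x$, then $\partial_C^-\mathfrak F(x)\cup\partial_C^+\mathfrak F(x)=C'_N(x)$, the set $C'_N(x)$ has exactly one element, and $\mathfrak F$ is Fréchet differentiable at $x$. 3. If, for every $k\ge 1$ with $d_k(x)\ne0$, either $d_k(x)\,(\lambda_k(x)-\lambda_{k+1}(x))<0$ or $d_\bullet(x)$ is constant on the cluster of $k$ at $x$, then $\partial_C^-\mathfrak F(x)=\partial_C^+\mathfrak F(x)=C'_N(x)$. The same conclusion holds if, for every $k\ge1$ with $d_k(x)\ne0$, either $-d_k(x)\,(\lambda_k(x)-\lambda_{k-1}(x))<0$ or $d_\bullet(x)$ is constant on the cluster of $k$ at $x$ (for $k=1$ the first alternative means $d_1(x)>0$). -/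

import Mathlib

open Filter Topology

noncomputable section

/-! ### Clarke differentials of a real function on a normed space -/

section Clarke

variable {X : Type*} [NormedAddCommGroup X] [NormedSpace ℝ X]

/-- Generalized upper directional derivative of `f` at `x` in the direction `h`:
the upper limit of `(f (y + t h) - f y) / t` as `y → x` and `t ↓ 0`, with values in `[-∞, ∞]`. -/
def clarkeUpper (f : X → ℝ) (x h : X) : EReal :=
  limsup (fun p : X × ℝ => (((f (p.1 + p.2 • h) - f p.1) / p.2 : ℝ) : EReal))
    (𝓝 x ×ˢ 𝓝[>] (0 : ℝ))

/-- Generalized lower directional derivative of `f` at `x` in the direction `h`. -/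
def clarkeLower (f : X → ℝ) (x h : X) : EReal :=
  liminf (fun p : X × ℝ => (((f (p.1 + p.2 • h) - f p.1) / p.2 : ℝ) : EReal))
    (𝓝 x ×ˢ 𝓝[>] (0 : ℝ))

/-- The Clarke subdifferential `∂_C^- f(x)`. -/
def clarkeSubdiff (f : X → ℝ) (x : X) : Set (X →L[ℝ] ℝ) :=
  {ζ | ∀ h : X, ((ζ h : ℝ) : EReal) ≤ clarkeUpper f x h}

/-- The Clarke superdifferential `∂_C^+ f(x)`. -/
def clarkeSuperdiff (f : X → ℝ) (x : X) : Set (X →L[ℝ] ℝ) :=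
  {ζ | ∀ h : X, clarkeLower f x h ≤ ((ζ h : ℝ) : EReal)}

end Clarke

/-! ### Parametrized Rayleigh quotients -/

/-- A family, parametrized by `x : X`, of quadratic forms `Q(x,·)` on `Y` and `G(x,·)` on a
subspace `H` of `Y`. Only parameters in an open set `Ω` will matter. -/
structure RayleighPair (X Y : Type*) [AddCommGroup Y] [Module ℝ Y] where
  /-- the common domain of the forms `G(x,·)` -/
  H : Submodule ℝ Y
  /-- the denominator -/
  Q : X → QuadraticForm ℝ Y
  /-- the numerator -/
  G : X → QuadraticForm ℝ H

namespace RayleighPair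

variable {X Y : Type*} [NormedAddCommGroup X] [NormedSpace ℝ X] [AddCommGroup Y] [Module ℝ Y]
variable (R : RayleighPair X Y)

/-- The symmetric bilinear form `B(x,·,·)` associated with `Q(x,·)`. -/
def B (x : X) (u v : Y) : ℝ := QuadraticMap.polar (R.Q x) u v / 2

/-- The symmetric bilinear form `Γ(x,·,·)` associated with `G(x,·)`. -/
def Gam (x : X) (u v : R.H) : ℝ := QuadraticMap.polar (R.G x) u v / 2

/-- The Rayleigh quotient on `H` (it is `+∞` outside `H`). -/
def quot (x : X) (u : R.H) : ℝ := R.G x u / R.Q x (u : Y)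

/-- Fréchet derivative of `Q(·,u)` at `x`. -/
def Qx (x : X) (u : Y) : X →L[ℝ] ℝ := fderiv ℝ (fun y => R.Q y u) x

/-- Fréchet derivative of `G(·,u)` at `x`. -/
def Gx (x : X) (u : R.H) : X →L[ℝ] ℝ := fderiv ℝ (fun y => R.G y u) x

/-- Fréchet derivative of `B(·,u,v)` at `x`. -/
def Bx (x : X) (u v : Y) : X →L[ℝ] ℝ := fderiv ℝ (fun y => R.B y u v) x

/-- Fréchet derivative of `Γ(·,u,v)` at `x`. -/
def Gamx (x : X) (u v : R.H) : X →L[ℝ] ℝ := fderiv ℝ (fun y => R.Gam y u v) x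

/-- Fréchet derivative of the Rayleigh quotient `𝓡(·,u)` at `x`. -/
def quotx (x : X) (u : R.H) : X →L[ℝ] ℝ := fderiv ℝ (fun y => R.quot y u) x

/-- `N(x,u)² = G(x,u) + θ(x) Q(x,u)` for `u ∈ H`. -/
def normSq (θ : X → ℝ) (x : X) (u : R.H) : ℝ := R.G x u + θ x * R.Q x (u : Y)

/-- `N(x,u) = [G(x,u) + θ(x) Q(x,u)]^{1/2}` for `u ∈ H`. -/
def nrm (θ : X → ℝ) (x : X) (u : R.H) : ℝ := Real.sqrt (R.normSq θ x u)

/-- `N(x,·)` is a Hilbert norm on `H`: `N(x,·)²` is positive definite and `H` is complete. -/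
def IsHilbertNorm (θ : X → ℝ) (x : X) : Prop :=
  (∀ u : R.H, u ≠ 0 → 0 < R.normSq θ x u) ∧
  ∀ u : ℕ → R.H,
    (∀ ε : ℝ, 0 < ε → ∃ M : ℕ, ∀ m n : ℕ, M ≤ m → M ≤ n → R.nrm θ x (u m - u n) < ε) →
    ∃ v : R.H, Tendsto (fun n => R.nrm θ x (u n - v)) atTop (𝓝 0)

/-- The standing assumptions at a point `x` of `Ω`, for a neighborhood `V` of `x` and a bounded
positive function `θ` on `V`. -/
structure LocalAssumptions (Ω V : Set X) (θ : X → ℝ) (x : X) : Prop where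
  nhds : V ∈ 𝓝 x
  subset : V ⊆ Ω
  theta_pos : ∀ y ∈ V, 0 < θ y
  theta_bdd : ∃ M : ℝ, ∀ y ∈ V, θ y ≤ M
  hilbert : ∀ y ∈ V, R.IsHilbertNorm θ y
  /-- the norms `N(y,·)`, `y ∈ V`, are uniformly equivalent -/
  equiv : ∃ C : ℝ, 1 ≤ C ∧ ∀ y ∈ V, ∀ u : R.H,
    C⁻¹ * R.nrm θ y u ≤ R.nrm θ x u ∧ R.nrm θ x u ≤ C * R.nrm θ y u
  /-- compactness along sequences of parameters converging to `x` -/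
  compact : ∀ (xs : ℕ → X) (us : ℕ → R.H), (∀ n, xs n ∈ V) → Tendsto xs atTop (𝓝 x) →
    (∃ M : ℝ, ∀ n, R.nrm θ (xs n) (us n) ≤ M) →
    ∃ (u : R.H) (φ : ℕ → ℕ), StrictMono φ ∧
      Tendsto (fun n => R.Q (xs (φ n)) ((us (φ n) : Y) - u)) atTop (𝓝 0) ∧
      ∀ h : R.H, Tendsto (fun n => R.Gam (xs (φ n)) (us (φ n)) h) atTop (𝓝 (R.Gam x u h))
  diffQ : ∀ u : Y, DifferentiableAt ℝ (fun y => R.Q y u) x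
  diffG : ∀ v : R.H, DifferentiableAt ℝ (fun y => R.G y v) x
  contQ : ∀ (xs : ℕ → X) (us : ℕ → Y) (u : Y), (∀ n, xs n ∈ V) → Tendsto xs atTop (𝓝 x) →
    Tendsto (fun n => R.Q (xs n) (us n - u)) atTop (𝓝 0) →
    Tendsto (fun n => R.Q (xs n) (us n)) atTop (𝓝 (R.Q x u)) ∧
    Tendsto (fun n => R.Qx (xs n) (us n)) atTop (𝓝 (R.Qx x u))
  contG : ∀ (xs : ℕ → X) (vs : ℕ → R.H) (v : R.H), (∀ n, xs n ∈ V) → Tendsto xs atTop (𝓝 x) →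
    Tendsto (fun n => R.nrm θ (xs n) (vs n - v)) atTop (𝓝 0) →
    Tendsto (fun n => R.G (xs n) (vs n)) atTop (𝓝 (R.G x v)) ∧
    Tendsto (fun n => R.Gx (xs n) (vs n)) atTop (𝓝 (R.Gx x v))
  /-- bounds on the derivatives of the bilinear forms, in the norm of the dual of `X`
  (vectors outside `H` have `N = +∞`, so that the first bound only concerns `H`) -/
  bound : ∃ C₀ : ℝ, 0 < C₀ ∧ ∀ y ∈ V, ∀ u v : R.H,
    ‖R.Bx y (u : Y) (v : Y)‖ ≤ C₀ * R.nrm θ y u * R.nrm θ y v ∧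
    ‖R.Gamx y u v‖ ≤ C₀ * R.nrm θ y u * R.nrm θ y v

/-- The standing assumptions on the Rayleigh quotient over the parameter set `Ω`. -/
structure StandingAssumptions (Ω : Set X) : Prop where
  posDef : ∀ x ∈ Ω, (R.Q x).PosDef
  /-- `H` is dense in `Y` for the norm `Q(x,·)^{1/2}` -/
  dense : ∀ x ∈ Ω, ∀ u : Y, ∀ ε : ℝ, 0 < ε → ∃ v : R.H, R.Q x (u - v) < ε
  loc : ∀ x ∈ Ω, ∃ (V : Set X) (θ : X → ℝ), R.LocalAssumptions Ω V θ x

/-- The `k`-th eigenvalue `λ_k(x)`, `k ≥ 1`, given by the min-max formula over the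
`k`-dimensional subspaces `E` of `H` and the `Q(x,·)`-unit sphere of `E`. -/
def eigenvalue (k : ℕ) (x : X) : ℝ :=
  sInf ((fun E : Submodule ℝ R.H => sSup (R.quot x '' {u : R.H | u ∈ E ∧ R.Q x (u : Y) = 1})) ''
    {E : Submodule ℝ R.H | Module.finrank ℝ E = k})

/-- `R.IsImage x u γ` says that `u` is in the domain of the operator `L(x)` and `L(x) u = γ`,
that is, `Γ(x,u,v) = B(x,γ,v)` for all `v ∈ H` (such a `γ` is unique, `H` being dense). -/
def IsImage (x : X) (u : R.H) (γ : Y) : Prop := ∀ v : R.H, R.Gam x u v = R.B x γ (v : Y)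

/-- The eigenspace `E_k(x) = {u ∈ H : L(x) u = λ_k(x) u}`. -/
def eigenspace (k : ℕ) (x : X) : Set R.H := {u | R.IsImage x u (R.eigenvalue k x • (u : Y))}

/-- The set of `Q(x,·)`-orthonormal families `(u_1, …, u_N)` with `u_k ∈ E_k(x)`
(the entry with index `i : Fin N` is `u_{i+1}`). -/
def orthonormalFamilies (N : ℕ) (x : X) : Set (Fin N → R.H) :=
  {u | (∀ i : Fin N, u i ∈ R.eigenspace (i + 1) x) ∧
    ∀ i j : Fin N, R.B x (u i : Y) (u j : Y) = if i = j then 1 else 0}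

/-- The point `(λ_1(x), …, λ_N(x))`. -/
def eigenvalueVec (N : ℕ) (x : X) : Fin N → ℝ := fun i => R.eigenvalue (i + 1) x

/-- `𝔉(x) = F(λ_1(x), …, λ_N(x))`. -/
def combination {N : ℕ} (F : (Fin N → ℝ) → ℝ) (x : X) : ℝ := F (R.eigenvalueVec N x)

/-- `d_k(x) = ∂_k F(λ_1(x), …, λ_N(x))` if `1 ≤ k ≤ N`, and `0` otherwise. -/
def weight {N : ℕ} (F : (Fin N → ℝ) → ℝ) (k : ℕ) (x : X) : ℝ :=
  if hk : 1 ≤ k ∧ k ≤ N then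
    fderiv ℝ F (R.eigenvalueVec N x) (Pi.single (⟨k - 1, by omega⟩ : Fin N) 1)
  else 0

/-- `C'_N(x)`: the convex hull of the functionals `∑_{k=1}^N d_k(x) 𝓡_x(x,u_k)` over the
orthonormal families `(u_k)` of eigenvectors. -/
def hull {N : ℕ} (F : (Fin N → ℝ) → ℝ) (x : X) : Set (X →L[ℝ] ℝ) :=
  convexHull ℝ ((fun u : Fin N → R.H => ∑ i : Fin N, R.weight F (i + 1) x • R.quotx x (u i)) ''
    R.orthonormalFamilies N x)

/-- The set of indices `j ≥ 1` with `λ_j(x) = λ_k(x)`. -/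
def cluster (k : ℕ) (x : X) : Set ℕ := {j | 1 ≤ j ∧ R.eigenvalue j x = R.eigenvalue k x}

/-- `j ↦ d_j(x)` is constant on the cluster of `k`. -/
def ConstOnCluster {N : ℕ} (F : (Fin N → ℝ) → ℝ) (k : ℕ) (x : X) : Prop :=
  ∀ i ∈ R.cluster k x, ∀ j ∈ R.cluster k x, R.weight F i x = R.weight F j x

/-- `d_k(x) (λ_k(x) - λ_{k+1}(x)) < 0`. -/
def UpperGap {N : ℕ} (F : (Fin N → ℝ) → ℝ) (k : ℕ) (x : X) : Prop :=
  R.weight F k x * (R.eigenvalue k x - R.eigenvalue (k + 1) x) < 0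

/-- `-d_k(x) (λ_k(x) - λ_{k-1}(x)) < 0`, with the convention `λ_0(x) = -∞`, by which the condition
for `k = 1` is `d_1(x) > 0`. -/
def LowerGap {N : ℕ} (F : (Fin N → ℝ) → ℝ) (k : ℕ) (x : X) : Prop :=
  (k = 1 ∧ 0 < R.weight F k x) ∨
    (2 ≤ k ∧ -(R.weight F k x * (R.eigenvalue k x - R.eigenvalue (k - 1) x)) < 0)

end RayleighPair

end

/-!
Restricted to `H`, the forms `B(x,·,·)` and `Γ(x,·,·)` make up a pair with a compactness property,
so that the min-max values `λ_k(x)` are the eigenvalues of an orthonormal sequence of eigenvectors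
(`CompactFormPair.spectral`). Two facts on sequences `z_n → x` carry the proof. Eigenfamilies at
`z_n` have a subsequence that converges strongly to an eigenfamily `w` at `x`
(`exists_subseq_eigenFamily`); this uses the continuity of the eigenvalues (`continuousAt_minMax`).
Testing the eigenvalue equation at `z_n` with an eigenvector at `x`, and conversely, then gives
`λ_k(z_n) - λ_k(x) = ⟨𝓡_x(x,w_k), z_n - x⟩ + o(‖z_n - x‖)` (`first_variation`,
`eigenvalue_expansion`), whence an expansion of `𝔉 = F(λ_1,…,λ_N)` (`combination_expansion`).

* `∂_C^∓ 𝔉 ⊆ C'`: the directional derivative of `𝔉` along a suitable sequence `z + t h`, `t ↓ 0`, is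
  the value at `h` of an element of `C'_N(z)`. These values are upper semicontinuous in `z`
  (`eventually_apply_le`), so a mean value inequality (`clarkeUpper_le`) bounds the generalized
  derivative by the support function of `C'_N(x)`. As `C'_N(x)` is the convex hull of a compact set
  in a finite-dimensional space, it is weak-* closed, and a vector `h` separates it from any other
  functional (`exists_eval_separation`). Replacing `y` by `y + t h` shows that the sub- and
  superdifferential are always equal (`clarkeSuperdiff_eq_clarkeSubdiff`).
* `C' ⊆ ∂_C^∓ 𝔉`: in a direction `h` the limit family `w` diagonalizes the derivative of the forms on
  each eigenspace, with diagonal entries in increasing order (`exists_directional`). On a cluster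
  where the weights `d_k` are constant only the trace counts, which no choice of basis affects
  (`sum_quotx_cluster`). Under a gap condition the remaining weights are positive and sit at the last
  (or the first) index of their cluster, where `w` maximizes (or minimizes) the derivative
  (`exists_directional_compare`). Comparing with other families bounds `clarkeUpper` from below, or
  `clarkeLower` from above.
* If the weights are constant on all clusters, the linear part of the expansion of `𝔉` does not depend
  on the limit family. So `C'` is a singleton, and by a subsequence argument `𝔉` is differentiable.
-/

open Filter Topology

noncomputable section

/-! ### Spectral theory of a pair of symmetric forms with a compactness property -/

section Spectral

variable {E : Type*} [AddCommGroup E] [Module ℝ E]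

/-- Two symmetric forms `b`, `g` on a real vector space, `b` positive definite and `g` bounded below
relatively to `b`, such that sequences bounded for `g + θ b` have subsequences that converge
strongly for `b` and weakly for `g`. -/
structure CompactFormPair (b g : LinearMap.BilinForm ℝ E) (θ : ℝ) : Prop where
  b_symm : ∀ u v, b u v = b v u
  g_symm : ∀ u v, g u v = g v u
  b_pos : ∀ u, u ≠ 0 → 0 < b u u
  nonneg : ∀ u, 0 ≤ g u u + θ * b u u
  compact : ∀ us : ℕ → E, (∃ M : ℝ, ∀ n, g (us n) (us n) + θ * b (us n) (us n) ≤ M) →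
    ∃ (u : E) (φ : ℕ → ℕ), StrictMono φ ∧
      Tendsto (fun n => b (us (φ n) - u) (us (φ n) - u)) atTop (𝓝 0) ∧
      ∀ h, Tendsto (fun n => g (us (φ n)) h) atTop (𝓝 (g u h))

/-- The `k`-th min-max value of the quotient `g u u / b u u`, `k ≥ 1`; eigenvalues are numbered from
`1`, families of vectors from `0`. -/
def minMax (b g : LinearMap.BilinForm ℝ E) (k : ℕ) : ℝ :=
  sInf ((fun V : Submodule ℝ E => sSup ((fun u => g u u / b u u) '' {u | u ∈ V ∧ b u u = 1})) ''
    {V : Submodule ℝ E | Module.finrank ℝ V = k})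

/-- `IsEigenFamily b g m w` says that `w 0, …, w (m - 1)` are `b`-orthonormal and that `w i` is an
eigenvector for the eigenvalue of index `i + 1`; the values `w i` with `m ≤ i` are irrelevant. -/
structure IsEigenFamily (b g : LinearMap.BilinForm ℝ E) (m : ℕ) (w : ℕ → E) : Prop where
  eigen : ∀ i < m, ∀ v, g (w i) v = minMax b g (i + 1) * b (w i) v
  ortho : ∀ i < m, ∀ j < m, b (w i) (w j) = if i = j then 1 else 0

theorem IsEigenFamily.mono {b g : LinearMap.BilinForm ℝ E} {m n : ℕ} {w : ℕ → E}
    (hw : IsEigenFamily b g n w) (hmn : m ≤ n) : IsEigenFamily b g m w :=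
  ⟨fun i hi => hw.eigen i (by omega), fun i hi j hj => hw.ortho i (by omega) j (by omega)⟩

theorem LinearMap.BilinForm.tendsto_left_of_tendsto_sub {b : LinearMap.BilinForm ℝ E}
    (hs : ∀ u v, b u v = b v u) (h0 : ∀ u, 0 ≤ b u u) {us : ℕ → E} {u : E}
    (h : Tendsto (fun n => b (us n - u) (us n - u)) atTop (𝓝 0)) (v : E) :
    Tendsto (fun n => b (us n) v) atTop (𝓝 (b u v)) := by
  rw [tendsto_iff_norm_sub_tendsto_zero]
  have h1 : Tendsto (fun n => √(b (us n - u) (us n - u) * b v v)) atTop (𝓝 0) := by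
    simpa using (h.mul_const (b v v)).sqrt
  refine squeeze_zero (fun _ => norm_nonneg _) (fun n => ?_) h1
  apply Real.le_sqrt_of_sq_le
  rw [Real.norm_eq_abs, sq_abs, ← LinearMap.sub_apply, ← map_sub]
  exact LinearMap.BilinForm.apply_sq_le_of_symm b h0 ⟨fun x y => by simpa using hs x y⟩ _ _

theorem LinearMap.BilinForm.tendsto_self_of_tendsto_sub {b : LinearMap.BilinForm ℝ E}
    (hs : ∀ u v, b u v = b v u) (h0 : ∀ u, 0 ≤ b u u) {us : ℕ → E} {u : E}
    (h : Tendsto (fun n => b (us n - u) (us n - u)) atTop (𝓝 0)) :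
    Tendsto (fun n => b (us n) (us n)) atTop (𝓝 (b u u)) := by
  have h1 := (h.add ((tendsto_left_of_tendsto_sub hs h0 h u).const_mul 2)).sub_const (b u u)
  refine (h1.congr fun n => ?_).trans (by ring_nf; rfl)
  simp only [map_sub, LinearMap.sub_apply, hs u (us n)]
  ring

/-- A quadratic form is bounded on the unit sphere of a finite-dimensional Euclidean space. -/
theorem LinearMap.BilinForm.exists_abs_le_mul {b : LinearMap.BilinForm ℝ E}
    (hp : ∀ u, u ≠ 0 → 0 < b u u) (g : LinearMap.BilinForm ℝ E)
    (V : Submodule ℝ E) [FiniteDimensional ℝ V] :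
    ∃ C : ℝ, ∀ u ∈ V, |g u u| ≤ C * b u u := by
  let e := (Module.finBasis ℝ V).equivFun.symm
  let L : (Fin (Module.finrank ℝ V) → ℝ) →ₗ[ℝ] E := V.subtype ∘ₗ e.toLinearMap
  have hL : ∀ c, c ≠ 0 → L c ≠ 0 := fun c hc h => hc (by simpa [L] using h)
  have hcont : ∀ a : LinearMap.BilinForm ℝ E, Continuous fun c => a (L c) (L c) := fun a => by
    let T := LinearMap.toContinuousLinearMap
      ((LinearMap.toContinuousLinearMap :
        ((Fin (Module.finrank ℝ V) → ℝ) →ₗ[ℝ] ℝ) ≃ₗ[ℝ] _).toLinearMap ∘ₗ (a.compl₁₂ L L))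
    exact (T.continuous.clm_apply continuous_id).congr fun c => by simp [T]
  have hsph := isCompact_sphere (0 : Fin (Module.finrank ℝ V) → ℝ) 1
  obtain ⟨C, hC⟩ := hsph.exists_bound_of_continuousOn
    (f := fun c => g (L c) (L c) / b (L c) (L c))
    ((hcont g).continuousOn.div (hcont b).continuousOn fun c hc =>
      (hp _ (hL c (ne_zero_of_mem_sphere one_ne_zero ⟨c, hc⟩))).ne')
  refine ⟨C, fun u hu => ?_⟩
  obtain ⟨c, rfl⟩ : ∃ c, L c = u := ⟨e.symm ⟨u, hu⟩, by simp [L]⟩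
  rcases eq_or_ne c 0 with rfl | hc
  · simp
  have hn : ‖c‖ ≠ 0 := norm_ne_zero_iff.2 hc
  have h1 := hC (‖c‖⁻¹ • c) (by simp [norm_smul, hn])
  have hpos := hp _ (hL c hc)
  have h2 : g (L (‖c‖⁻¹ • c)) (L (‖c‖⁻¹ • c)) / b (L (‖c‖⁻¹ • c)) (L (‖c‖⁻¹ • c)) =
      g (L c) (L c) / b (L c) (L c) := by
    simp only [map_smul, LinearMap.smul_apply, smul_eq_mul]
    field_simp
  rwa [h2, Real.norm_eq_abs, abs_div, abs_of_pos hpos, div_le_iff₀ hpos] at h1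

namespace CompactFormPair

variable {b g : LinearMap.BilinForm ℝ E} {θ : ℝ}

theorem b_nonneg (h : CompactFormPair b g θ) (u : E) : 0 ≤ b u u := by
  rcases eq_or_ne u 0 with rfl | hu
  · simp
  · exact (h.b_pos u hu).le

theorem exists_unit_mem (h : CompactFormPair b g θ) {V : Submodule ℝ E} {u : E} (hu : u ∈ V)
    (h0 : u ≠ 0) : ∃ v ∈ V, b v v = 1 ∧ ∃ c : ℝ, v = c • u := by
  have hp := h.b_pos u h0
  refine ⟨(√(b u u))⁻¹ • u, V.smul_mem _ hu, ?_, _, rfl⟩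
  have h2 : √(b u u) * √(b u u) = b u u := Real.mul_self_sqrt hp.le
  have h3 : √(b u u) ≠ 0 := (Real.sqrt_pos.2 hp).ne'
  simp only [map_smul, LinearMap.smul_apply, smul_eq_mul]
  field_simp
  nlinarith

theorem bddAbove (h : CompactFormPair b g θ) (V : Submodule ℝ E) [FiniteDimensional ℝ V] :
    BddAbove ((fun u => g u u / b u u) '' {u | u ∈ V ∧ b u u = 1}) := by
  obtain ⟨C, hC⟩ := LinearMap.BilinForm.exists_abs_le_mul h.b_pos g V
  refine ⟨C, ?_⟩
  rintro _ ⟨u, ⟨hu, h1⟩, rfl⟩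
  have := (le_abs_self _).trans (hC u hu)
  simp_all

theorem bddBelow (h : CompactFormPair b g θ) {k : ℕ} (hk : 1 ≤ k) :
    BddBelow ((fun V : Submodule ℝ E =>
      sSup ((fun u => g u u / b u u) '' {u | u ∈ V ∧ b u u = 1})) ''
        {V : Submodule ℝ E | Module.finrank ℝ V = k}) := by
  refine ⟨-θ, ?_⟩
  rintro _ ⟨V, hV, rfl⟩
  have hV' : Module.finrank ℝ V = k := hV
  have : FiniteDimensional ℝ V := Module.finite_of_finrank_pos (by omega)
  have hnt : V ≠ ⊥ := by
    rintro rfl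
    simp at hV'
    omega
  obtain ⟨u, hu, h0⟩ := V.ne_bot_iff.1 hnt
  obtain ⟨v, hv, hv1, -⟩ := h.exists_unit_mem hu h0
  refine le_csSup_of_le (h.bddAbove V) ⟨v, ⟨hv, hv1⟩, rfl⟩ ?_
  have := h.nonneg v
  simp only [hv1] at *
  linarith

theorem minMax_le (h : CompactFormPair b g θ) {k : ℕ} (hk : 1 ≤ k) {V : Submodule ℝ E}
    (hV : Module.finrank ℝ V = k) {c : ℝ} (hc : ∀ u ∈ V, g u u ≤ c * b u u) :
    minMax b g k ≤ c := by
  refine csInf_le_of_le (h.bddBelow hk) ⟨V, hV, rfl⟩ ?_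
  have hnt : V ≠ ⊥ := by
    rintro rfl
    simp at hV
    omega
  obtain ⟨u, hu, h0⟩ := V.ne_bot_iff.1 hnt
  obtain ⟨v, hv, hv1, -⟩ := h.exists_unit_mem hu h0
  refine csSup_le ⟨_, v, ⟨hv, hv1⟩, rfl⟩ ?_
  rintro _ ⟨w, ⟨hw, hw1⟩, rfl⟩
  have := hc w hw
  simp_all

theorem le_minMax (h : CompactFormPair b g θ) (hE : ¬ FiniteDimensional ℝ E) {k : ℕ} (hk : 1 ≤ k)
    {c : ℝ} (hc : ∀ V : Submodule ℝ E, Module.finrank ℝ V = k →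
      ∃ u ∈ V, u ≠ 0 ∧ c * b u u ≤ g u u) : c ≤ minMax b g k := by
  have hne : ∃ V : Submodule ℝ E, Module.finrank ℝ V = k := by
    obtain ⟨f, hf⟩ := exists_linearIndependent_of_le_rank (R := ℝ) (M := E) (n := k)
      ((Cardinal.natCast_lt_aleph0).le.trans
        (not_lt.1 fun hlt => hE (Module.rank_lt_aleph0_iff.1 hlt)))
    exact ⟨_, by simpa using finrank_span_eq_card hf⟩
  refine le_csInf (hne.imp' _ fun V hV => ⟨V, hV, rfl⟩) ?_
  rintro _ ⟨V, hV, rfl⟩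
  have hV' : Module.finrank ℝ V = k := hV
  have : FiniteDimensional ℝ V := Module.finite_of_finrank_pos (by omega)
  obtain ⟨u, hu, h0, hcu⟩ := hc V hV
  obtain ⟨v, hv, hv1, r, rfl⟩ := h.exists_unit_mem hu h0
  refine le_csSup_of_le (h.bddAbove V) ⟨_, ⟨hv, hv1⟩, rfl⟩ ?_
  simp only [map_smul, LinearMap.smul_apply, smul_eq_mul] at *
  rw [hv1, div_one]
  have h1 := mul_le_mul_of_nonneg_left hcu (mul_self_nonneg r)
  have h2 : c * (r * (r * b u u)) = c := by rw [hv1, mul_one]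
  linarith

/-- The quotient is minimized on the `b`-orthogonal complement of a finite set. -/
theorem exists_minimizer (h : CompactFormPair b g θ) (hE : ¬ FiniteDimensional ℝ E) (S : Finset E) :
    ∃ u, b u u = 1 ∧ (∀ s ∈ S, b u s = 0) ∧
      ∀ v, (∀ s ∈ S, b v s = 0) → g u u * b v v ≤ g v v := by
  obtain ⟨u₀, hu0, hu0S⟩ : ∃ u, u ≠ 0 ∧ ∀ s ∈ S, b u s = 0 := by
    let T : E →ₗ[ℝ] (S → ℝ) := LinearMap.pi fun s => b.flip s
    have hT : ¬ Function.Injective T := fun hi => hE (FiniteDimensional.of_injective T hi)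
    rw [← LinearMap.ker_eq_bot, ← ne_eq, Submodule.ne_bot_iff] at hT
    obtain ⟨u, hu, h0⟩ := hT
    exact ⟨u, h0, fun s hs => congrFun (LinearMap.mem_ker.1 hu) ⟨s, hs⟩⟩
  let A : Set ℝ := (fun v => g v v) '' {v | b v v = 1 ∧ ∀ s ∈ S, b v s = 0}
  have hA : A.Nonempty := by
    obtain ⟨v, -, hv1, r, rfl⟩ := h.exists_unit_mem (Submodule.mem_top (x := u₀)) hu0
    exact ⟨_, r • u₀, ⟨hv1, fun s hs => by simp [hu0S s hs]⟩, rfl⟩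
  have hAb : BddBelow A := ⟨-θ, by
    rintro _ ⟨v, ⟨hv, -⟩, rfl⟩
    have := h.nonneg v
    simp only [hv] at *
    linarith⟩
  obtain ⟨r, -, hr, hrA⟩ := exists_seq_tendsto_sInf hA hAb
  choose us hus hus' using hrA
  obtain ⟨M, hM⟩ := hr.bddAbove_range
  obtain ⟨u, φ, hφ, hbu, hgu⟩ := h.compact us ⟨M + θ, fun n => by
    have h1 : r n ≤ M := hM ⟨n, rfl⟩
    have h2 : g (us n) (us n) = r n := hus' n
    rw [h2, (hus n).1]
    linarith⟩
  have hb1 := LinearMap.BilinForm.tendsto_left_of_tendsto_sub h.b_symm h.b_nonneg hbu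
  have hb2 := LinearMap.BilinForm.tendsto_self_of_tendsto_sub h.b_symm h.b_nonneg hbu
  have hu1 : b u u = 1 := tendsto_nhds_unique hb2 (by simp [(hus _).1])
  have huS : ∀ s ∈ S, b u s = 0 := fun s hs =>
    tendsto_nhds_unique (hb1 s) (by simp [(hus _).2 s hs])
  have hle : g u u ≤ sInf A := by
    -- weak lower semicontinuity of `g`: expand `0 ≤ g (uₙ - u) (uₙ - u) + θ b (uₙ - u) (uₙ - u)`
    have h1 := (((hr.comp hφ.tendsto_atTop).sub ((hgu u).const_mul 2)).add_const (g u u)).add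
      (hbu.const_mul θ)
    have h2 := ge_of_tendsto' h1 fun n => by
      have := h.nonneg (us (φ n) - u)
      have h2 : g (us (φ n)) (us (φ n)) = r (φ n) := hus' (φ n)
      have h3 : g (us (φ n) - u) (us (φ n) - u) = r (φ n) - 2 * g (us (φ n)) u + g u u := by
        rw [← h2]
        simp only [map_sub, LinearMap.sub_apply, h.g_symm u (us (φ n))]
        ring
      rw [h3] at this
      exact this
    linarith
  refine ⟨u, hu1, huS, fun v hv => ?_⟩
  rcases eq_or_ne v 0 with rfl | h0
  · simp
  obtain ⟨v', -, hv1, c, rfl⟩ := h.exists_unit_mem (Submodule.mem_top (x := v)) h0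
  have h4 : sInf A ≤ g (c • v) (c • v) :=
    csInf_le hAb ⟨_, ⟨hv1, fun s hs => by simp [hv s hs]⟩, rfl⟩
  simp only [map_smul, LinearMap.smul_apply, smul_eq_mul] at *
  have h5 : g u u ≤ c * (c * g v v) := hle.trans h4
  have h6 := h.b_nonneg v
  have h7 : b v v * (g u u) ≤ b v v * (c * (c * g v v)) := mul_le_mul_of_nonneg_left h5 h6
  calc g u u * b v v ≤ b v v * (c * (c * g v v)) := by linarith
    _ = (c * (c * b v v)) * g v v := by ring
    _ = g v v := by rw [hv1, one_mul]

/-- There is an infinite orthonormal sequence of eigenvectors, obtained by successive minimizations,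
whose eigenvalues are the min-max values and minimize the quotient on orthogonal complements. -/
theorem exists_eigenSequence (h : CompactFormPair b g θ) (hE : ¬ FiniteDimensional ℝ E) :
    ∃ w : ℕ → E, (∀ i j, b (w i) (w j) = if i = j then 1 else 0) ∧
      (∀ i v, g (w i) v = g (w i) (w i) * b (w i) v) ∧
      ∀ i v, (∀ j < i, b v (w j) = 0) → g (w i) (w i) * b v v ≤ g v v := by
  classical
  choose m hm1 hm2 hm3 using h.exists_minimizer hE
  let S : ℕ → Finset E := fun n => Nat.rec ∅ (fun _ T => insert (m T) T) n
  have hS : ∀ n, S (n + 1) = insert (m (S n)) (S n) := fun n => rfl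
  have hmem : ∀ n v, v ∈ S n ↔ ∃ j < n, v = m (S j) := by
    intro n
    induction n with
    | zero => simp [S]
    | succ n ih =>
      intro v
      rw [hS, Finset.mem_insert, ih]
      constructor
      · rintro (rfl | ⟨j, hj, rfl⟩)
        · exact ⟨n, by omega, rfl⟩
        · exact ⟨j, by omega, rfl⟩
      · rintro ⟨j, hj, rfl⟩
        rcases Nat.lt_succ_iff_lt_or_eq.1 hj with hj | rfl
        · exact Or.inr ⟨j, hj, rfl⟩
        · exact Or.inl rfl
  have hlt : ∀ i j, j < i → b (m (S i)) (m (S j)) = 0 := fun i j hj =>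
    hm2 _ _ ((hmem i _).2 ⟨j, hj, rfl⟩)
  have hortho : ∀ i j, b (m (S i)) (m (S j)) = if i = j then 1 else 0 := by
    intro i j
    rcases lt_trichotomy i j with hij | rfl | hij
    · rw [h.b_symm, hlt j i hij, if_neg hij.ne]
    · rw [hm1, if_pos rfl]
    · rw [hlt i j hij, if_neg hij.ne']
  have hmin : ∀ i v, (∀ j < i, b v (m (S j)) = 0) →
      g (m (S i)) (m (S i)) * b v v ≤ g v v := fun i v hv => by
    refine hm3 _ v fun s hs => ?_
    obtain ⟨j, hj, rfl⟩ := (hmem i s).1 hs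
    exact hv j hj
  -- first variation on the orthogonal complement of the previous vectors
  have hvar : ∀ i v, (∀ j < i, b v (m (S j)) = 0) →
      g (m (S i)) v = g (m (S i)) (m (S i)) * b (m (S i)) v := by
    intro i v hv
    set u := m (S i)
    set μ := g u u
    have hq : ∀ t : ℝ,
        0 ≤ t * (2 * (g u v - μ * b u v)) + t ^ 2 * (g v v - μ * b v v) := fun t => by
      have := hmin i (u + t • v) fun j hj => by simp [hv j hj, hlt i j hj, u]
      simp only [map_add, LinearMap.add_apply, map_smul, LinearMap.smul_apply, smul_eq_mul,
        h.b_symm v u, h.g_symm v u] at this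
      rw [show b u u = 1 from hm1 _] at this
      simp only [μ] at this ⊢
      linarith
    by_contra hne
    set a := g u v - μ * b u v with ha
    have ha0 : a ≠ 0 := sub_ne_zero.2 hne
    set d := g v v - μ * b v v
    have h1 := hq (-a / (|d| + 1))
    have hd : 0 < |d| + 1 := by positivity
    have h2 : -a / (|d| + 1) * (2 * a) + (-a / (|d| + 1)) ^ 2 * d =
        a ^ 2 / (|d| + 1) ^ 2 * (d - 2 * (|d| + 1)) := by
      field_simp
      ring
    rw [h2] at h1
    have h3 : 0 < a ^ 2 / (|d| + 1) ^ 2 := by positivity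
    nlinarith [le_abs_self d, abs_nonneg d]
  refine ⟨fun n => m (S n), hortho, fun i => ?_, hmin⟩
  induction i using Nat.strong_induction_on with
  | _ i ih =>
    intro v
    set v' := v - ∑ j ∈ Finset.range i, b v (m (S j)) • m (S j) with hv'
    have h1 : ∀ j < i, b v' (m (S j)) = 0 := fun j hj => by
      simp only [hv', map_sub, LinearMap.sub_apply, map_sum, LinearMap.sum_apply, map_smul,
        LinearMap.smul_apply, hortho, smul_eq_mul, mul_ite, mul_one, mul_zero]
      rw [Finset.sum_ite_eq', if_pos (Finset.mem_range.2 hj), sub_self]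
    have h2 := hvar i v' h1
    have h3 : ∀ j < i, g (m (S i)) (m (S j)) = 0 := fun j hj => by
      rw [h.g_symm, ih j hj, hortho, if_neg hj.ne, mul_zero]
    have h4 : g (m (S i)) v' = g (m (S i)) v := by
      simp only [hv', map_sub, map_sum, map_smul, smul_eq_mul]
      rw [Finset.sum_eq_zero fun j hj => by rw [h3 j (Finset.mem_range.1 hj), mul_zero], sub_zero]
    have h5 : b (m (S i)) v' = b (m (S i)) v := by
      simp only [hv', map_sub, map_sum, map_smul, smul_eq_mul]
      rw [Finset.sum_eq_zero fun j hj => by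
        rw [hlt i j (Finset.mem_range.1 hj), mul_zero], sub_zero]
    rw [← h4, ← h5, h2]

/-- The span of an orthonormal family that diagonalizes `g`, with diagonal entries at most `c`. -/
theorem exists_submodule_of_orthonormal {k : ℕ} {w : ℕ → E} {μ : ℕ → ℝ} {c : ℝ}
    (hw : ∀ i < k, ∀ j < k, b (w i) (w j) = if i = j then 1 else 0)
    (hg : ∀ i < k, ∀ j < k, g (w i) (w j) = μ i * b (w i) (w j)) (hμ : ∀ i < k, μ i ≤ c) :
    ∃ V : Submodule ℝ E, Module.finrank ℝ V = k ∧ ∀ u ∈ V, g u u ≤ c * b u u := by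
  have hw' : ∀ i j : Fin k, b (w i) (w j) = if i = j then 1 else 0 := fun i j => by
    rw [hw i i.2 j j.2]
    simp [Fin.ext_iff]
  have hli : LinearIndependent ℝ fun i : Fin k => w i := by
    rw [Fintype.linearIndependent_iff]
    intro r hr j
    have := congrArg (fun u => b u (w j)) hr
    simpa [hw'] using this
  refine ⟨Submodule.span ℝ (Set.range fun i : Fin k => w i),
    by simpa using finrank_span_eq_card hli, fun u hu => ?_⟩
  obtain ⟨r, rfl⟩ := (Submodule.mem_span_range_iff_exists_fun ℝ).1 hu
  have h1 : b (∑ i, r i • w i) (∑ i, r i • w i) = ∑ i, r i * r i := by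
    simp [hw']
  have h2 : g (∑ i, r i • w i) (∑ i, r i • w i) = ∑ i : Fin k, μ i * (r i * r i) := by
    have : ∀ i j : Fin k, g (w i) (w j) = if i = j then μ i else 0 := fun i j => by
      rw [hg i i.2 j j.2, hw', mul_ite, mul_one, mul_zero]
    simp only [map_sum, map_smul, LinearMap.sum_apply, LinearMap.smul_apply, this, smul_eq_mul,
      mul_ite, mul_zero, Finset.sum_ite_eq', Finset.mem_univ, if_true]
    refine Finset.sum_congr rfl fun i _ => ?_
    ring
  rw [h1, h2, Finset.mul_sum]
  exact Finset.sum_le_sum fun i _ => mul_le_mul_of_nonneg_right (hμ i i.2) (mul_self_nonneg _)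

/-- The min-max principle, upper bound: test with the span of an orthonormal family that
diagonalizes `g`. -/
theorem minMax_le_of_orthonormal (h : CompactFormPair b g θ) {k : ℕ} (hk : 1 ≤ k) {w : ℕ → E}
    {μ : ℕ → ℝ} {c : ℝ} (hw : ∀ i < k, ∀ j < k, b (w i) (w j) = if i = j then 1 else 0)
    (hg : ∀ i < k, ∀ j < k, g (w i) (w j) = μ i * b (w i) (w j)) (hμ : ∀ i < k, μ i ≤ c) :
    minMax b g k ≤ c := by
  obtain ⟨V, hV, hc⟩ := exists_submodule_of_orthonormal hw hg hμ
  exact h.minMax_le hk hV hc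

theorem minMax_succ_eq (h : CompactFormPair b g θ) (hE : ¬ FiniteDimensional ℝ E) {w : ℕ → E}
    (hw : ∀ i j, b (w i) (w j) = if i = j then 1 else 0)
    (hg : ∀ i v, g (w i) v = g (w i) (w i) * b (w i) v)
    (hmin : ∀ i v, (∀ j < i, b v (w j) = 0) → g (w i) (w i) * b v v ≤ g v v)
    (hmono : Monotone fun i => g (w i) (w i)) (k : ℕ) :
    minMax b g (k + 1) = g (w k) (w k) := by
  apply le_antisymm
  · exact h.minMax_le_of_orthonormal (by omega) (fun i _ j _ => hw i j) (fun i _ j _ => hg i (w j))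
      fun i hi => hmono (Nat.lt_succ_iff.1 hi)
  · refine h.le_minMax hE (by omega) fun V hV => ?_
    have : FiniteDimensional ℝ V := Module.finite_of_finrank_pos (by omega)
    let T : V →ₗ[ℝ] (Fin k → ℝ) := LinearMap.pi fun i => (b.flip (w i)) ∘ₗ V.subtype
    have hT : T.ker ≠ ⊥ := LinearMap.ker_ne_bot_of_finrank_lt (by simp [hV])
    obtain ⟨u, hu, h0⟩ := (Submodule.ne_bot_iff _).1 hT
    refine ⟨u, u.2, by simpa using h0, hmin k u fun j hj => ?_⟩
    exact congrFun (LinearMap.mem_ker.1 hu) ⟨j, hj⟩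

/-- The eigenvalues given by the min-max formula form a nondecreasing unbounded sequence, and every
finite part of it is realized by an orthonormal family of eigenvectors. -/
theorem spectral (h : CompactFormPair b g θ) (hE : ¬ FiniteDimensional ℝ E) :
    (∀ i j, i ≤ j → minMax b g (i + 1) ≤ minMax b g (j + 1)) ∧
    (∀ c : ℝ, ∃ k, c < minMax b g (k + 1)) ∧ ∃ w, ∀ m, IsEigenFamily b g m w := by
  obtain ⟨w, hw, hg, hmin⟩ := h.exists_eigenSequence hE
  have hmono : Monotone fun i => g (w i) (w i) := fun i j hij => by
    have := hmin i (w j) fun l hl => by rw [hw, if_neg (by omega)]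
    rwa [hw, if_pos rfl, mul_one] at this
  have hmm := h.minMax_succ_eq hE hw hg hmin hmono
  refine ⟨fun i j hij => by rw [hmm, hmm]; exact hmono hij, fun c => ?_, w, fun m =>
    ⟨fun i _ v => by rw [hmm, hg], fun i _ j _ => hw i j⟩⟩
  by_contra! hc
  obtain ⟨u, φ, hφ, hbu, -⟩ := h.compact w ⟨c + θ, fun n => by
    have := hc n
    rw [hmm] at this
    rw [hw, if_pos rfl]
    linarith⟩
  have h1 : Tendsto (fun n => 2 * b (w (φ n) - u) (w (φ n) - u) +
      2 * b (w (φ (n + 1)) - u) (w (φ (n + 1)) - u)) atTop (𝓝 0) := by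
    simpa using (hbu.const_mul 2).add ((hbu.comp (tendsto_add_atTop_nat 1)).const_mul 2)
  have h2 := ge_of_tendsto' (b := (2 : ℝ)) h1 fun n => by
    have hne : φ n ≠ φ (n + 1) := (hφ (Nat.lt_succ_self n)).ne
    have h3 := h.b_nonneg (w (φ n) + w (φ (n + 1)) - (2 : ℝ) • u)
    have h4 : b (w (φ n) + w (φ (n + 1)) - (2 : ℝ) • u) (w (φ n) + w (φ (n + 1)) - (2 : ℝ) • u) =
        2 * b (w (φ n) - u) (w (φ n) - u) +
      2 * b (w (φ (n + 1)) - u) (w (φ (n + 1)) - u) - 2 := by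
      simp only [map_sub, map_add, map_smul, LinearMap.sub_apply, LinearMap.add_apply,
        LinearMap.smul_apply, smul_eq_mul, hw, if_neg hne, if_neg hne.symm, h.b_symm u]
      simp
      ring
    linarith
  norm_num at h2

/-- The infimum in the min-max formula is attained. -/
theorem exists_submodule_le_minMax (h : CompactFormPair b g θ) (hE : ¬ FiniteDimensional ℝ E)
    (k : ℕ) : ∃ V : Submodule ℝ E, Module.finrank ℝ V = k + 1 ∧
      ∀ u ∈ V, g u u ≤ minMax b g (k + 1) * b u u := by
  obtain ⟨hmono, -, w, hw⟩ := h.spectral hE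
  exact exists_submodule_of_orthonormal (hw (k + 1)).ortho
    (fun i hi j _ => (hw (k + 1)).eigen i hi (w j)) fun i hi => hmono i k (by omega)

/-- An eigenvector is a combination of the members of an eigenfamily that exhausts the eigenvalues
up to its own. -/
theorem eq_sum_of_eigen (h : CompactFormPair b g θ) (hE : ¬ FiniteDimensional ℝ E) {m : ℕ}
    {w : ℕ → E} (hw : IsEigenFamily b g m w) {l : ℝ} {u : E} (hu : ∀ v, g u v = l * b u v)
    (hm : ∀ i < m, minMax b g (i + 1) < minMax b g (m + 1)) (hl : l < minMax b g (m + 1)) :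
    u = ∑ i ∈ Finset.range m, b u (w i) • w i := by
  set v := u - ∑ i ∈ Finset.range m, b u (w i) • w i with hv
  suffices hv0 : v = 0 from sub_eq_zero.1 hv0
  by_contra hne
  have hzero : ∀ i < m, (l - minMax b g (i + 1)) * b u (w i) = 0 := fun i hi => by
    have h1 := hw.eigen i hi u
    rw [h.g_symm, hu, h.b_symm (w i)] at h1
    linarith
  have hbv : ∀ i < m, b v (w i) = 0 := fun i hi => by
    have h1 : ∑ j ∈ Finset.range m, b u (w j) * b (w j) (w i) = b u (w i) := by
      rw [Finset.sum_eq_single_of_mem i (Finset.mem_range.2 hi)]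
      · rw [hw.ortho i hi i hi, if_pos rfl, mul_one]
      · intro j hj hji
        rw [hw.ortho j (Finset.mem_range.1 hj) i hi, if_neg hji, mul_zero]
    simp [hv, h1]
  have hgv : ∀ z, g v z = l * b v z := fun z => by
    simp only [hv, map_sub, LinearMap.sub_apply, map_sum, LinearMap.sum_apply, map_smul,
      LinearMap.smul_apply, smul_eq_mul, hu, mul_sub, Finset.mul_sum]
    congr 1
    refine Finset.sum_congr rfl fun i hi => ?_
    rw [hw.eigen i (Finset.mem_range.1 hi)]
    linear_combination (-b (w i) z) * hzero i (Finset.mem_range.1 hi)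
  obtain ⟨v', -, hv1, c, rfl⟩ := h.exists_unit_mem (Submodule.mem_top (x := v)) hne
  -- `w 0, …, w (m - 1)` and the normalized `v` would give a too small `(m + 1)`-st value
  have hlt : ∃ d < minMax b g (m + 1), l ≤ d ∧ ∀ i < m, minMax b g (i + 1) ≤ d := by
    rcases Nat.eq_zero_or_pos m with rfl | hm0
    · exact ⟨l, hl, le_rfl, by simp⟩
    · refine ⟨max l (minMax b g (m - 1 + 1)), max_lt hl (hm _ (by omega)), le_max_left _ _,
        fun i hi => le_max_of_le_right ((h.spectral hE).1 _ _ (by omega))⟩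
  obtain ⟨d, hd, hld, hwd⟩ := hlt
  refine hd.not_ge (h.minMax_le_of_orthonormal (by omega)
    (w := fun i => if i < m then w i else c • v)
    (μ := fun i => if i < m then minMax b g (i + 1) else l) ?_ ?_ ?_)
  · intro i hi j hj
    by_cases him : i < m <;> by_cases hjm : j < m
    · simp only [him, hjm, if_true, hw.ortho i him j hjm]
    · rw [if_neg (show i ≠ j by omega)]
      simp only [him, hjm, if_true, if_false]
      rw [map_smul, h.b_symm, hbv i him, smul_zero]
    · rw [if_neg (show i ≠ j by omega)]
      simp only [him, hjm, if_true, if_false]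
      rw [map_smul, LinearMap.smul_apply, hbv j hjm, smul_zero]
    · simp only [him, hjm, if_false, hv1]
      rw [if_pos (by omega)]
  · intro i hi j hj
    by_cases him : i < m
    · simp only [him, if_true, hw.eigen i him]
    · simp only [him, if_false, map_smul, LinearMap.smul_apply, hgv, smul_eq_mul]
      ring
  · intro i hi
    by_cases him : i < m
    · simpa [him] using hwd i him
    · simpa [him] using hld

theorem apply_eq_zero_of_eigen (h : CompactFormPair b g θ) {l l' : ℝ} {u v : E}
    (hu : ∀ z, g u z = l * b u z) (hv : ∀ z, g v z = l' * b v z) (hne : l ≠ l') : b u v = 0 := by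
  have h1 := hu v
  rw [h.g_symm, hv, h.b_symm v] at h1
  exact (mul_eq_zero.1 (by linarith : (l - l') * b u v = 0)).resolve_left (sub_ne_zero.2 hne)

end CompactFormPair

/-- Invariance of the trace of a bilinear map: two families that expand into one another with
mutually transposed coefficients have the same trace. -/
theorem sum_apply_self_eq {W : Type*} [AddCommGroup W] [Module ℝ W] {b : LinearMap.BilinForm ℝ E}
    (hs : ∀ u v, b u v = b v u) (A : E →ₗ[ℝ] E →ₗ[ℝ] W) {I : Finset ℕ} {u w : ℕ → E}
    (hu : ∀ i ∈ I, u i = ∑ j ∈ I, b (u i) (w j) • w j)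
    (hw : ∀ j ∈ I, w j = ∑ i ∈ I, b (w j) (u i) • u i) :
    ∑ i ∈ I, A (u i) (u i) = ∑ i ∈ I, A (w i) (w i) := by
  calc ∑ i ∈ I, A (u i) (u i) = ∑ i ∈ I, ∑ j ∈ I, b (u i) (w j) • A (w j) (u i) := by
        refine Finset.sum_congr rfl fun i hi => ?_
        conv_lhs => enter [1]; rw [hu i hi]
        simp
    _ = ∑ j ∈ I, ∑ i ∈ I, b (w j) (u i) • A (w j) (u i) := by
        rw [Finset.sum_comm]
        simp only [hs (w _) (u _)]
    _ = ∑ j ∈ I, A (w j) (w j) := by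
        refine Finset.sum_congr rfl fun j hj => ?_
        conv_rhs => enter [2]; rw [hw j hj]
        simp

end Spectral

namespace RayleighPair

/-! ### The forms restricted to the common domain -/

section Forms

variable {X Y : Type*} [AddCommGroup Y] [Module ℝ Y] {R : RayleighPair X Y}

variable (R) in
/-- The restriction to `H` of the bilinear form `B(x,·,·)`. -/
def bForm (x : X) : LinearMap.BilinForm ℝ R.H :=
  ((1 / 2 : ℝ) • (R.Q x).polarBilin).compl₁₂ R.H.subtype R.H.subtype

variable (R) in
/-- The bilinear form `Γ(x,·,·)`. -/
def gForm (x : X) : LinearMap.BilinForm ℝ R.H := (1 / 2 : ℝ) • (R.G x).polarBilin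

theorem bForm_apply (x : X) (u v : R.H) : R.bForm x u v = R.B x u v := by
  simp [bForm, B, div_eq_inv_mul]

theorem gForm_apply (x : X) (u v : R.H) : R.gForm x u v = R.Gam x u v := by
  simp [gForm, Gam, div_eq_inv_mul]

theorem bForm_self (x : X) (u : R.H) : R.bForm x u u = R.Q x u := by
  simp [bForm, QuadraticMap.polar_self]

theorem gForm_self (x : X) (u : R.H) : R.gForm x u u = R.G x u := by
  simp [gForm, QuadraticMap.polar_self]

theorem bForm_symm (x : X) (u v : R.H) : R.bForm x u v = R.bForm x v u := by
  simp [bForm, QuadraticMap.polar_comm]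

theorem gForm_symm (x : X) (u v : R.H) : R.gForm x u v = R.gForm x v u := by
  simp [gForm, QuadraticMap.polar_comm]

theorem bForm_polarize (x : X) (u v : R.H) :
    R.bForm x u v = (R.Q x ((u + v : R.H) : Y) - R.Q x u - R.Q x v) / 2 := by
  rw [bForm_apply, B, QuadraticMap.polar, Submodule.coe_add]

theorem gForm_polarize (x : X) (u v : R.H) :
    R.gForm x u v = (R.G x (u + v) - R.G x u - R.G x v) / 2 := by
  rw [gForm_apply, Gam, QuadraticMap.polar]

theorem normSq_eq (θ : X → ℝ) (x : X) (u : R.H) :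
    R.normSq θ x u = R.gForm x u u + θ x * R.bForm x u u := by
  rw [normSq, gForm_self, bForm_self]

theorem eigenvalue_eq (k : ℕ) (x : X) : R.eigenvalue k x = minMax (R.bForm x) (R.gForm x) k := by
  simp only [eigenvalue, minMax, bForm_self, gForm_self]
  rfl

theorem mem_eigenspace_iff {k : ℕ} {x : X} {u : R.H} :
    u ∈ R.eigenspace k x ↔ ∀ v, R.gForm x u v = R.eigenvalue k x * R.bForm x u v := by
  refine forall_congr' fun v => ?_
  rw [gForm_apply, bForm_apply, B, B, QuadraticMap.polar_smul_left, smul_eq_mul, mul_div_assoc]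

end Forms

/-! ### Consequences of the local assumptions -/

variable {X Y : Type*} [NormedAddCommGroup X] [NormedSpace ℝ X] [AddCommGroup Y] [Module ℝ Y]
variable {R : RayleighPair X Y} {Ω V : Set X} {θ : X → ℝ} {x : X}

namespace LocalAssumptions

theorem normSq_nonneg (h : R.LocalAssumptions Ω V θ x) {z : X} (hz : z ∈ V) (u : R.H) :
    0 ≤ R.normSq θ z u := by
  rcases eq_or_ne u 0 with rfl | hu
  · simp [normSq]
  · exact ((h.hilbert z hz).1 u hu).le

theorem nrm_sq (h : R.LocalAssumptions Ω V θ x) {z : X} (hz : z ∈ V) (u : R.H) :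
    R.nrm θ z u ^ 2 = R.normSq θ z u := Real.sq_sqrt (h.normSq_nonneg hz u)

theorem mem (h : R.LocalAssumptions Ω V θ x) : x ∈ V := mem_of_mem_nhds h.nhds

theorem exists_normSq_le (h : R.LocalAssumptions Ω V θ x) :
    ∃ C : ℝ, 0 < C ∧ ∀ z ∈ V, ∀ u : R.H,
      R.normSq θ z u ≤ C * R.normSq θ x u ∧ R.normSq θ x u ≤ C * R.normSq θ z u := by
  obtain ⟨C, hC, hCV⟩ := h.equiv
  have hC0 : 0 < C := by linarith
  refine ⟨C ^ 2, by positivity, fun z hz u => ?_⟩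
  obtain ⟨h1, h2⟩ := hCV z hz u
  rw [inv_mul_le_iff₀ hC0] at h1
  rw [← h.nrm_sq hz, ← h.nrm_sq h.mem, ← mul_pow, ← mul_pow]
  exact ⟨pow_le_pow_left₀ (Real.sqrt_nonneg _) h1 2, pow_le_pow_left₀ (Real.sqrt_nonneg _) h2 2⟩

theorem compactFormPair (h : R.LocalAssumptions Ω V θ x) (hpos : (R.Q x).PosDef) :
    CompactFormPair (R.bForm x) (R.gForm x) (θ x) where
  b_symm := bForm_symm x
  g_symm := gForm_symm x
  b_pos u hu := by
    rw [bForm_self]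
    exact hpos _ (by simpa using hu)
  nonneg u := by
    rw [← normSq_eq]
    exact h.normSq_nonneg h.mem u
  compact us hus := by
    obtain ⟨M, hM⟩ := hus
    obtain ⟨u, φ, hφ, h1, h2⟩ := h.compact (fun _ => x) us (fun _ => h.mem) tendsto_const_nhds
      ⟨√M, fun n => Real.sqrt_le_sqrt (by rw [normSq_eq]; exact hM n)⟩
    refine ⟨u, φ, hφ, ?_, fun v => ?_⟩
    · simpa only [bForm_self, Submodule.coe_sub] using h1
    · simpa only [gForm_apply] using h2 v

end LocalAssumptions

namespace StandingAssumptions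

theorem exists_compactFormPair (hR : R.StandingAssumptions Ω) (hx : x ∈ Ω) :
    ∃ t, CompactFormPair (R.bForm x) (R.gForm x) t := by
  obtain ⟨V, θ, h⟩ := hR.loc x hx
  exact ⟨_, h.compactFormPair (hR.posDef x hx)⟩

theorem hasFDerivAt_bForm (hR : R.StandingAssumptions Ω) (hx : x ∈ Ω) (u v : R.H) :
    HasFDerivAt (fun z => R.bForm z u v) (R.Bx x u v) x := by
  obtain ⟨V, θ, h⟩ := hR.loc x hx
  have h1 : DifferentiableAt ℝ (fun z => R.bForm z u v) x := by
    simp only [bForm_polarize]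
    simp only [div_eq_inv_mul]
    exact (((h.diffQ _).fun_sub (h.diffQ _)).fun_sub (h.diffQ _)).const_mul _
  simpa only [Bx, bForm_apply] using h1.hasFDerivAt

theorem hasFDerivAt_gForm (hR : R.StandingAssumptions Ω) (hx : x ∈ Ω) (u v : R.H) :
    HasFDerivAt (fun z => R.gForm z u v) (R.Gamx x u v) x := by
  obtain ⟨V, θ, h⟩ := hR.loc x hx
  have h1 : DifferentiableAt ℝ (fun z => R.gForm z u v) x := by
    simp only [gForm_polarize]
    simp only [div_eq_inv_mul]
    exact (((h.diffG _).fun_sub (h.diffG _)).fun_sub (h.diffG _)).const_mul _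
  simpa only [Gamx, gForm_apply] using h1.hasFDerivAt

theorem Bx_polarize (hR : R.StandingAssumptions Ω) (hx : x ∈ Ω) (u v : R.H) :
    R.Bx x u v = (1 / 2 : ℝ) • (R.Qx x ((u + v : R.H) : Y) - R.Qx x u - R.Qx x v) := by
  obtain ⟨V, θ, h⟩ := hR.loc x hx
  have h1 := (((h.diffQ ((u + v : R.H) : Y)).hasFDerivAt.sub (h.diffQ u).hasFDerivAt).sub
    (h.diffQ v).hasFDerivAt).const_mul (1 / 2)
  refine (hR.hasFDerivAt_bForm hx u v).unique (h1.congr_of_eventuallyEq (.of_forall fun z => ?_))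
  simp only [bForm_polarize, Pi.sub_apply]
  ring

theorem Gamx_polarize (hR : R.StandingAssumptions Ω) (hx : x ∈ Ω) (u v : R.H) :
    R.Gamx x u v = (1 / 2 : ℝ) • (R.Gx x (u + v) - R.Gx x u - R.Gx x v) := by
  obtain ⟨V, θ, h⟩ := hR.loc x hx
  have h1 := (((h.diffG (u + v)).hasFDerivAt.sub (h.diffG u).hasFDerivAt).sub
    (h.diffG v).hasFDerivAt).const_mul (1 / 2)
  refine (hR.hasFDerivAt_gForm hx u v).unique (h1.congr_of_eventuallyEq (.of_forall fun z => ?_))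
  simp only [gForm_polarize, Pi.sub_apply]
  ring

theorem hasFDerivAt_gForm_sub_bForm (hR : R.StandingAssumptions Ω) (hx : x ∈ Ω) (l : ℝ)
    (u v : R.H) :
    HasFDerivAt (fun z => R.gForm z u v - l * R.bForm z u v) (R.Gamx x u v - l • R.Bx x u v) x :=
  (hR.hasFDerivAt_gForm hx u v).fun_sub ((hR.hasFDerivAt_bForm hx u v).const_mul l)

/-- The derivative at `x` of the form `Γ - l B`, as a bilinear map. On the eigenspace of `l` it
governs the first variation of the eigenvalues that are equal to `l` at `x`. -/
def derivForm (hR : R.StandingAssumptions Ω) (hx : x ∈ Ω) (l : ℝ) :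
    R.H →ₗ[ℝ] R.H →ₗ[ℝ] (X →L[ℝ] ℝ) :=
  LinearMap.mk₂ ℝ (fun u v => R.Gamx x u v - l • R.Bx x u v)
    (fun u u' v => (hR.hasFDerivAt_gForm_sub_bForm hx l (u + u') v).unique
      (((hR.hasFDerivAt_gForm_sub_bForm hx l u v).add
        (hR.hasFDerivAt_gForm_sub_bForm hx l u' v)).congr_of_eventuallyEq
          (.of_forall fun z => by simp; ring)))
    (fun c u v => (hR.hasFDerivAt_gForm_sub_bForm hx l (c • u) v).unique
      (((hR.hasFDerivAt_gForm_sub_bForm hx l u v).const_mul c).congr_of_eventuallyEq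
        (.of_forall fun z => by simp; ring)))
    (fun u v v' => (hR.hasFDerivAt_gForm_sub_bForm hx l u (v + v')).unique
      (((hR.hasFDerivAt_gForm_sub_bForm hx l u v).add
        (hR.hasFDerivAt_gForm_sub_bForm hx l u v')).congr_of_eventuallyEq
          (.of_forall fun z => by simp; ring)))
    (fun c u v => (hR.hasFDerivAt_gForm_sub_bForm hx l u (c • v)).unique
      (((hR.hasFDerivAt_gForm_sub_bForm hx l u v).const_mul c).congr_of_eventuallyEq
        (.of_forall fun z => by simp; ring)))

theorem derivForm_apply (hR : R.StandingAssumptions Ω) (hx : x ∈ Ω) (l : ℝ) (u v : R.H) :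
    hR.derivForm hx l u v = R.Gamx x u v - l • R.Bx x u v := rfl

/-- The derivative of the Rayleigh quotient at a normalized vector. -/
theorem quotx_eq (hR : R.StandingAssumptions Ω) (hx : x ∈ Ω) {l : ℝ} {u : R.H}
    (hu : R.bForm x u u = 1) (hl : R.gForm x u u = l) : R.quotx x u = hR.derivForm hx l u u := by
  have h1 := (hR.hasFDerivAt_gForm hx u u).fun_mul
    ((hasDerivAt_inv (x := R.bForm x u u) (by simp [hu])).comp_hasFDerivAt x
      (hR.hasFDerivAt_bForm hx u u))
  have h2 : R.quotx x u = _ := HasFDerivAt.fderiv (f := fun y => R.quot y u) (by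
    simpa only [quot, ← bForm_self, ← gForm_self, div_eq_mul_inv, Function.comp_apply] using h1)
  rw [h2, derivForm_apply]
  simp [hu, hl, sub_eq_neg_add]

/-- The diagonal values of the forms are locally Lipschitz, uniformly on bounded sets for the
norm `N(x,·)`. -/
theorem exists_lipschitz (hR : R.StandingAssumptions Ω) (h : R.LocalAssumptions Ω V θ x) :
    ∃ r L : ℝ, 0 < r ∧ 0 ≤ L ∧ Metric.ball x r ⊆ V ∧
      ∀ z ∈ Metric.ball x r, ∀ z' ∈ Metric.ball x r, ∀ u : R.H,
        |R.bForm z u u - R.bForm z' u u| ≤ L * ‖z - z'‖ * R.normSq θ x u ∧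
        |R.gForm z u u - R.gForm z' u u| ≤ L * ‖z - z'‖ * R.normSq θ x u := by
  obtain ⟨r, hr, hrV⟩ := Metric.mem_nhds_iff.1 h.nhds
  obtain ⟨C, hC, hCV⟩ := h.exists_normSq_le
  obtain ⟨C₀, hC₀, hb⟩ := h.bound
  have key : ∀ z ∈ Metric.ball x r, ∀ u : R.H,
      C₀ * R.nrm θ z u * R.nrm θ z u ≤ C₀ * C * R.normSq θ x u := fun z hz u => by
    have := (hCV z (hrV hz) u).1
    rw [mul_assoc, ← sq, h.nrm_sq (hrV hz), mul_assoc]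
    gcongr
  refine ⟨r, C₀ * C, hr, by positivity, hrV, fun z hz z' hz' u => ⟨?_, ?_⟩⟩
  · have := (convex_ball x r).norm_image_sub_le_of_norm_hasFDerivWithin_le
      (fun y hy => (hR.hasFDerivAt_bForm (h.subset (hrV hy)) u u).hasFDerivWithinAt)
      (fun y hy => ((hb y (hrV hy) u u).1).trans (key y hy u)) hz' hz
    rw [Real.norm_eq_abs] at this
    linarith
  · have := (convex_ball x r).norm_image_sub_le_of_norm_hasFDerivWithin_le
      (fun y hy => (hR.hasFDerivAt_gForm (h.subset (hrV hy)) u u).hasFDerivWithinAt)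
      (fun y hy => ((hb y (hrV hy) u u).2).trans (key y hy u)) hz' hz
    rw [Real.norm_eq_abs] at this
    linarith

/-- The eigenvalues are continuous functions of the parameter. -/
theorem continuousAt_minMax (hR : R.StandingAssumptions Ω) (hH : ¬ FiniteDimensional ℝ R.H)
    (hx : x ∈ Ω) (k : ℕ) : ContinuousAt (fun z => minMax (R.bForm z) (R.gForm z) (k + 1)) x := by
  obtain ⟨V, θ, h⟩ := hR.loc x hx
  obtain ⟨r, L, hr, hL, hrV, hLip⟩ := hR.exists_lipschitz h
  obtain ⟨C, hC, hCV⟩ := h.exists_normSq_le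
  obtain ⟨M, hM⟩ := h.theta_bdd
  set lam : X → ℝ := fun z => minMax (R.bForm z) (R.gForm z) (k + 1) with hlam
  set Λ : ℝ := max |M| (|lam x| + 1) with hΛ
  have hΛM : M ≤ Λ := (le_abs_self M).trans (le_max_left _ _)
  have hΛ1 : 1 ≤ Λ := le_trans (by linarith [abs_nonneg (lam x)]) (le_max_right |M| _)
  set a : ℝ := C * (2 * Λ) with ha
  have ha0 : 0 ≤ a := by positivity
  have hbn : ∀ z ∈ V, ∀ u, 0 ≤ R.bForm z u u := fun z hz u =>
    (hR.exists_compactFormPair (h.subset hz)).choose_spec.b_nonneg u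
  -- the perturbation estimate between two parameters of the ball
  have key : ∀ z ∈ Metric.ball x r, ∀ z' ∈ Metric.ball x r, lam z ≤ Λ → -Λ ≤ lam z →
      L * ‖z - z'‖ * a ≤ 1 / 2 → lam z' ≤ lam z + 2 * (Λ + 1) * (L * ‖z - z'‖ * a) := by
    intro z hz z' hz' hzΛ hzΛ' hsmall
    obtain ⟨t, hp⟩ := hR.exists_compactFormPair (h.subset (hrV hz))
    obtain ⟨t', hp'⟩ := hR.exists_compactFormPair (h.subset (hrV hz'))
    obtain ⟨W, hW, hWu⟩ := hp.exists_submodule_le_minMax hH k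
    refine hp'.minMax_le (by omega) hW fun u hu => ?_
    have h1 : R.gForm z u u ≤ lam z * R.bForm z u u := hWu u hu
    have hb := hbn z (hrV hz) u
    have hb' := hbn z' (hrV hz') u
    have h2 : R.normSq θ x u ≤ a * R.bForm z u u := by
      refine (hCV z (hrV hz) u).2.trans ?_
      rw [ha, mul_assoc]
      refine mul_le_mul_of_nonneg_left ?_ hC.le
      rw [normSq_eq]
      have := mul_le_mul_of_nonneg_right ((hM z (hrV hz)).trans hΛM) hb
      have := mul_le_mul_of_nonneg_right hzΛ hb
      linarith
    obtain ⟨h3, h4⟩ := hLip z hz z' hz' u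
    set δ := L * ‖z - z'‖ with hδ
    have hδ0 : 0 ≤ δ := by positivity
    have h5 : δ * R.normSq θ x u ≤ δ * a * R.bForm z u u := by
      rw [mul_assoc δ a]
      exact mul_le_mul_of_nonneg_left h2 hδ0
    have h6 := abs_le.1 (h3.trans h5)
    have h7 := abs_le.1 (h4.trans h5)
    have hδa : 0 ≤ δ * a := by positivity
    have h8 : R.bForm z u u ≤ 2 * R.bForm z' u u := by
      have := mul_le_mul_of_nonneg_right hsmall hb
      linarith
    have h9 : lam z * (R.bForm z u u - R.bForm z' u u) ≤ Λ * (δ * a * R.bForm z u u) := by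
      rw [← abs_le] at h6
      calc _ ≤ |lam z * (R.bForm z u u - R.bForm z' u u)| := le_abs_self _
        _ = |lam z| * |R.bForm z u u - R.bForm z' u u| := abs_mul _ _
        _ ≤ _ := mul_le_mul (abs_le.2 ⟨hzΛ', hzΛ⟩) h6 (abs_nonneg _) (by linarith)
    have h10 : (Λ + 1) * (δ * a) * R.bForm z u u ≤ (Λ + 1) * (δ * a) * (2 * R.bForm z' u u) :=
      mul_le_mul_of_nonneg_left h8 (by positivity)
    linarith
  have hlow : ∀ z ∈ V, -Λ ≤ lam z := fun z hz => by
    obtain ⟨t, hp⟩ := hR.exists_compactFormPair (h.subset hz)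
    refine hp.le_minMax hH (by omega) fun W hW => ?_
    obtain ⟨u, hu, h0⟩ := W.ne_bot_iff.1 (by rintro rfl; simp at hW)
    refine ⟨u, hu, h0, ?_⟩
    have h1 := h.normSq_nonneg hz u
    rw [normSq_eq] at h1
    have := mul_le_mul_of_nonneg_right ((hM z hz).trans hΛM) (hbn z hz u)
    linarith
  have hxr : x ∈ Metric.ball x r := Metric.mem_ball_self hr
  have hxΛ : lam x + 1 ≤ Λ := le_trans (by linarith [le_abs_self (lam x)]) (le_max_right |M| _)
  have ht : Tendsto (fun z => 2 * (Λ + 1) * (L * ‖z - x‖ * a)) (𝓝 x) (𝓝 0) := by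
    have : Continuous fun z : X => 2 * (Λ + 1) * (L * ‖z - x‖ * a) := by fun_prop
    simpa using this.tendsto x
  have hev : ∀ᶠ z in 𝓝 x, |lam z - lam x| ≤ 2 * (Λ + 1) * (L * ‖z - x‖ * a) := by
    filter_upwards [Metric.ball_mem_nhds x hr, ht.eventually (gt_mem_nhds one_pos)] with z hz hz1
    have h0 : 0 ≤ L * ‖z - x‖ * a := by positivity
    have hsm : L * ‖z - x‖ * a ≤ 1 / 2 := by nlinarith
    have h1 := key x hxr z hz (by linarith) (hlow x (hrV hxr)) (by rwa [norm_sub_rev])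
    rw [norm_sub_rev] at h1
    have h2 := key z hz x hxr (by linarith) (hlow z (hrV hz)) hsm
    exact abs_le.2 ⟨by linarith, by linarith⟩
  exact tendsto_iff_norm_sub_tendsto_zero.2
    (squeeze_zero' (.of_forall fun _ => norm_nonneg _) hev ht)

end StandingAssumptions

end RayleighPair

/-! ### Strong convergence and passage to the limit in the forms -/

theorem LinearMap.BilinForm.tendsto_add_sub_add {E : Type*} [AddCommGroup E] [Module ℝ E]
    {a : LinearMap.BilinForm ℝ E} (h0 : ∀ u, 0 ≤ a u u) {us vs : ℕ → E} {u v : E}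
    (hu : Tendsto (fun n => a (us n - u) (us n - u)) atTop (𝓝 0))
    (hv : Tendsto (fun n => a (vs n - v) (vs n - v)) atTop (𝓝 0)) :
    Tendsto (fun n => a (us n + vs n - (u + v)) (us n + vs n - (u + v))) atTop (𝓝 0) := by
  have h1 : Tendsto (fun n => 2 * a (us n - u) (us n - u) + 2 * a (vs n - v) (vs n - v)) atTop
      (𝓝 0) := by simpa using (hu.const_mul 2).add (hv.const_mul 2)
  refine squeeze_zero (fun n => h0 _) (fun n => ?_) h1
  have h2 := h0 ((us n - u) - (vs n - v))
  rw [show us n + vs n - (u + v) = (us n - u) + (vs n - v) by abel]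
  simp only [map_add, map_sub, LinearMap.add_apply, LinearMap.sub_apply] at h2 ⊢
  linarith

/-- A property of sequences that can be achieved, for each of finitely many indices, along a
subsequence of any subsequence, can be achieved for all of them along a common subsequence. -/
theorem exists_common_subseq (P : ℕ → (ℕ → ℕ) → Prop)
    (hmono : ∀ i φ ψ, P i φ → StrictMono ψ → P i (φ ∘ ψ))
    {m : ℕ} (hex : ∀ i < m, ∀ φ : ℕ → ℕ, StrictMono φ → ∃ ψ : ℕ → ℕ, StrictMono ψ ∧ P i (φ ∘ ψ)) :
    ∃ φ : ℕ → ℕ, StrictMono φ ∧ ∀ i < m, P i φ := by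
  induction m with
  | zero => exact ⟨id, strictMono_id, by simp⟩
  | succ m ih =>
    obtain ⟨φ, hφ, hP⟩ := ih fun i hi => hex i (by omega)
    obtain ⟨ψ, hψ, hPm⟩ := hex m (by omega) φ hφ
    refine ⟨φ ∘ ψ, hφ.comp hψ, fun i hi => ?_⟩
    rcases Nat.lt_succ_iff_lt_or_eq.1 hi with hi | rfl
    · exact hmono _ _ _ (hP i hi) hψ
    · exact hPm

namespace RayleighPair

section StrongConvergence

variable {X Y : Type*} [AddCommGroup Y] [Module ℝ Y] {R : RayleighPair X Y} {θ : X → ℝ} {x : X}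

variable (R) in
/-- Convergence of a sequence in `H`, both for `Q(x,·)` and for `N(x,·)`. -/
def StronglyTendsto (θ : X → ℝ) (x : X) (us : ℕ → R.H) (u : R.H) : Prop :=
  Tendsto (fun n => R.bForm x (us n - u) (us n - u)) atTop (𝓝 0) ∧
    Tendsto (fun n => R.normSq θ x (us n - u)) atTop (𝓝 0)

theorem StronglyTendsto.comp {us : ℕ → R.H} {u : R.H} (hu : R.StronglyTendsto θ x us u)
    {φ : ℕ → ℕ} (hφ : StrictMono φ) : R.StronglyTendsto θ x (us ∘ φ) u :=
  ⟨hu.1.comp hφ.tendsto_atTop, hu.2.comp hφ.tendsto_atTop⟩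

theorem stronglyTendsto_const (u : R.H) : R.StronglyTendsto θ x (fun _ => u) u := by
  constructor
  · simp
  · simp [normSq_eq]

end StrongConvergence

variable {X Y : Type*} [NormedAddCommGroup X] [NormedSpace ℝ X] [AddCommGroup Y] [Module ℝ Y]
variable {R : RayleighPair X Y} {Ω V : Set X} {θ : X → ℝ} {x : X}

namespace StandingAssumptions

theorem stronglyTendsto_add (hR : R.StandingAssumptions Ω) (h : R.LocalAssumptions Ω V θ x)
    {us vs : ℕ → R.H} {u v : R.H} (hu : R.StronglyTendsto θ x us u)
    (hv : R.StronglyTendsto θ x vs v) :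
    R.StronglyTendsto θ x (fun n => us n + vs n) (u + v) := by
  obtain ⟨t, hp⟩ := hR.exists_compactFormPair (h.subset h.mem)
  refine ⟨LinearMap.BilinForm.tendsto_add_sub_add hp.b_nonneg hu.1 hv.1, ?_⟩
  have heq : ∀ w, R.normSq θ x w = (R.gForm x + θ x • R.bForm x) w w := fun w => by
    simp [normSq_eq]
  have h2 := hu.2
  have h3 := hv.2
  simp only [heq] at h2 h3 ⊢
  exact LinearMap.BilinForm.tendsto_add_sub_add
    (fun w => by rw [← heq]; exact h.normSq_nonneg h.mem w) h2 h3

/-- A strongly convergent sequence also converges for the forms at parameters tending to `x`. -/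
theorem tendsto_sub_of_stronglyTendsto (hR : R.StandingAssumptions Ω)
    (h : R.LocalAssumptions Ω V θ x) {zs : ℕ → X} (hzs : Tendsto zs atTop (𝓝 x))
    {us : ℕ → R.H} {u : R.H} (hu : R.StronglyTendsto θ x us u) :
    Tendsto (fun n => R.bForm (zs n) (us n - u) (us n - u)) atTop (𝓝 0) ∧
      Tendsto (fun n => R.normSq θ (zs n) (us n - u)) atTop (𝓝 0) := by
  obtain ⟨r, L, hr, hL, hrV, hLip⟩ := hR.exists_lipschitz h
  obtain ⟨C, hC, hCV⟩ := h.exists_normSq_le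
  have hev := hzs.eventually (Metric.ball_mem_nhds x hr)
  constructor
  · have hz : Tendsto (fun n => ‖zs n - x‖) atTop (𝓝 0) := tendsto_iff_norm_sub_tendsto_zero.1 hzs
    have h1 : Tendsto (fun n => R.bForm x (us n - u) (us n - u) +
        L * ‖zs n - x‖ * R.normSq θ x (us n - u)) atTop (𝓝 0) := by
      simpa using hu.1.add ((hz.const_mul L).mul hu.2)
    refine squeeze_zero' ?_ ?_ h1
    · filter_upwards [hev] with n hn
      exact (hR.exists_compactFormPair (h.subset (hrV hn))).choose_spec.b_nonneg _
    · filter_upwards [hev] with n hn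
      have := (abs_le.1 (hLip _ hn x (Metric.mem_ball_self hr) (us n - u)).1).2
      linarith
  · refine squeeze_zero' ?_ ?_ (by simpa using hu.2.const_mul C)
    · filter_upwards [hev] with n hn
      exact h.normSq_nonneg (hrV hn) _
    · filter_upwards [hev] with n hn
      exact (hCV _ (hrV hn) _).1

theorem tendsto_diag (hR : R.StandingAssumptions Ω)
    (h : R.LocalAssumptions Ω V θ x) {zs : ℕ → X} (hzs : Tendsto zs atTop (𝓝 x))
    {us : ℕ → R.H} {u : R.H} (hu : R.StronglyTendsto θ x us u) :
    (Tendsto (fun n => R.Q (zs n) (us n)) atTop (𝓝 (R.Q x u)) ∧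
      Tendsto (fun n => R.Qx (zs n) (us n)) atTop (𝓝 (R.Qx x u))) ∧
    Tendsto (fun n => R.G (zs n) (us n)) atTop (𝓝 (R.G x u)) ∧
      Tendsto (fun n => R.Gx (zs n) (us n)) atTop (𝓝 (R.Gx x u)) := by
  obtain ⟨n₀, hn₀⟩ := eventually_atTop.1 (hzs.eventually h.nhds)
  obtain ⟨h1, h2⟩ := hR.tendsto_sub_of_stronglyTendsto h hzs hu
  have hsh : Tendsto (fun n => n + n₀) atTop atTop := tendsto_add_atTop_nat n₀
  have hQ := h.contQ (fun n => zs (n + n₀)) (fun n => us (n + n₀)) u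
    (fun n => hn₀ _ (by omega)) (hzs.comp hsh) (by
      simpa only [bForm_self, Submodule.coe_sub, Function.comp_def] using h1.comp hsh)
  have hG := h.contG (fun n => zs (n + n₀)) (fun n => us (n + n₀)) u
    (fun n => hn₀ _ (by omega)) (hzs.comp hsh) (by
      simpa [nrm] using (h2.comp hsh).sqrt)
  exact ⟨⟨(tendsto_add_atTop_iff_nat (f := fun n => R.Q (zs n) (us n)) n₀).1 hQ.1,
    (tendsto_add_atTop_iff_nat (f := fun n => R.Qx (zs n) (us n)) n₀).1 hQ.2⟩,
    (tendsto_add_atTop_iff_nat (f := fun n => R.G (zs n) (us n)) n₀).1 hG.1,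
    (tendsto_add_atTop_iff_nat (f := fun n => R.Gx (zs n) (us n)) n₀).1 hG.2⟩

section
variable (hR : R.StandingAssumptions Ω) (h : R.LocalAssumptions Ω V θ x) {zs : ℕ → X}
  (hzs : Tendsto zs atTop (𝓝 x)) {us vs : ℕ → R.H} {u v : R.H}
  (hu : R.StronglyTendsto θ x us u) (hv : R.StronglyTendsto θ x vs v)
include hR h hzs hu hv

theorem tendsto_bForm :
    Tendsto (fun n => R.bForm (zs n) (us n) (vs n)) atTop (𝓝 (R.bForm x u v)) := by
  simp only [bForm_polarize]
  exact (((hR.tendsto_diag h hzs (hR.stronglyTendsto_add h hu hv)).1.1.sub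
    (hR.tendsto_diag h hzs hu).1.1).sub (hR.tendsto_diag h hzs hv).1.1).div_const 2

theorem tendsto_deriv {ls : ℕ → ℝ} {l : ℝ} (hl : Tendsto ls atTop (𝓝 l)) :
    Tendsto (fun n => R.Gamx (zs n) (us n) (vs n) - ls n • R.Bx (zs n) (us n) (vs n)) atTop
      (𝓝 (R.Gamx x u v - l • R.Bx x u v)) := by
  have hev : ∀ᶠ n in atTop, zs n ∈ Ω :=
    (hzs.eventually h.nhds).mono fun n hn => h.subset hn
  have hadd := hR.tendsto_diag h hzs (hR.stronglyTendsto_add h hu hv)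
  have h1 := (((hadd.2.2.sub (hR.tendsto_diag h hzs hu).2.2).sub
    (hR.tendsto_diag h hzs hv).2.2).const_smul (1 / 2 : ℝ)).sub
    (hl.smul (((hadd.1.2.sub (hR.tendsto_diag h hzs hu).1.2).sub
    (hR.tendsto_diag h hzs hv).1.2).const_smul (1 / 2 : ℝ)))
  rw [hR.Gamx_polarize (h.subset h.mem), hR.Bx_polarize (h.subset h.mem)]
  refine h1.congr' ?_
  filter_upwards [hev] with n hn
  rw [hR.Gamx_polarize hn, hR.Bx_polarize hn]

end

/-! ### Compactness and first-order expansion of eigenvectors -/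

/-- Normalized eigenvectors at parameters tending to `x`, with convergent eigenvalues, have a
strongly convergent subsequence, and the limit is a normalized eigenvector. -/
theorem exists_subseq_eigenvector (hR : R.StandingAssumptions Ω) (h : R.LocalAssumptions Ω V θ x)
    {zs : ℕ → X} (hzs : Tendsto zs atTop (𝓝 x)) {us : ℕ → R.H} {ls : ℕ → ℝ} {l : ℝ}
    (hl : Tendsto ls atTop (𝓝 l)) (h1 : ∀ n, R.bForm (zs n) (us n) (us n) = 1)
    (hus : ∀ n v, R.gForm (zs n) (us n) v = ls n * R.bForm (zs n) (us n) v) :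
    ∃ (φ : ℕ → ℕ) (u : R.H), StrictMono φ ∧ R.StronglyTendsto θ x (us ∘ φ) u ∧
      ∀ v, R.gForm x u v = l * R.bForm x u v := by
  obtain ⟨r, L, hr, hL, hrV, hLip⟩ := hR.exists_lipschitz h
  obtain ⟨C, hC, hCV⟩ := h.exists_normSq_le
  obtain ⟨n₀, hn₀⟩ := eventually_atTop.1 (hzs.eventually (Metric.ball_mem_nhds x hr))
  have hsh : Tendsto (fun n => n + n₀) atTop atTop := tendsto_add_atTop_nat n₀
  obtain ⟨M, hM⟩ := h.theta_bdd
  obtain ⟨M', hM'⟩ := hl.bddAbove_range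
  have hball : ∀ n, zs (n + n₀) ∈ Metric.ball x r := fun n => hn₀ _ (by omega)
  obtain ⟨u, φ, hφ, hQ, hG⟩ := h.compact (fun n => zs (n + n₀)) (fun n => us (n + n₀))
    (fun n => hrV (hball n)) (hzs.comp hsh) ⟨√(M' + M), fun n => Real.sqrt_le_sqrt (by
      have h2 : ls (n + n₀) ≤ M' := hM' ⟨_, rfl⟩
      have h3 := hM _ (hrV (hball n))
      rw [normSq_eq, hus, h1]
      linarith)⟩
  set ψ : ℕ → ℕ := fun n => φ n + n₀ with hψ
  have hψm : StrictMono ψ := hφ.add_const n₀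
  have hzψ : Tendsto (fun n => zs (ψ n)) atTop (𝓝 x) := hzs.comp hψm.tendsto_atTop
  have hlψ : Tendsto (fun n => ls (ψ n)) atTop (𝓝 l) := hl.comp hψm.tendsto_atTop
  have hQ' : Tendsto (fun n => R.bForm (zs (ψ n)) (us (ψ n) - u) (us (ψ n) - u)) atTop (𝓝 0) := by
    simpa only [bForm_self, Submodule.coe_sub] using hQ
  have hG' : ∀ v, Tendsto (fun n => R.gForm (zs (ψ n)) (us (ψ n)) v) atTop (𝓝 (R.gForm x u v)) := by
    simpa only [gForm_apply] using hG
  have hb1 : ∀ v : R.H, Tendsto (fun n => R.bForm (zs (ψ n)) (us (ψ n)) v) atTop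
      (𝓝 (R.bForm x u v)) := fun v => by
    have hz0 := (hR.tendsto_diag h hzψ (stronglyTendsto_const v)).1.1
    have hq1 := (h.contQ (fun n => zs (ψ n)) (fun n => us (ψ n)) u
      (fun n => hrV (hball _)) hzψ hQ).1
    have hq2 := (h.contQ (fun n => zs (ψ n)) (fun n => ((us (ψ n) + v : R.H) : Y)) (u + v : R.H)
      (fun n => hrV (hball _)) hzψ (by simpa using hQ)).1
    simp only [bForm_polarize]
    exact ((hq2.sub hq1).sub hz0).div_const 2
  have heig : ∀ v, R.gForm x u v = l * R.bForm x u v := fun v =>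
    tendsto_nhds_unique (hG' v) (by simpa only [hus] using hlψ.mul (hb1 v))
  -- the energies converge as well, which turns weak convergence into strong convergence
  have hgu : Tendsto (fun n => R.gForm (zs (ψ n)) (us (ψ n) - u) (us (ψ n) - u)) atTop (𝓝 0) := by
    have hz0 := (hR.tendsto_diag h hzψ (stronglyTendsto_const u)).2.1
    have hq1 := (h.contQ (fun n => zs (ψ n)) (fun n => us (ψ n)) u
      (fun n => hrV (hball _)) hzψ hQ).1
    have hone : R.bForm x u u = 1 := by
      rw [bForm_self]
      refine tendsto_nhds_unique hq1 ?_
      simp only [← bForm_self, h1]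
      exact tendsto_const_nhds
    have h2 := ((hlψ.sub ((hG' u).const_mul 2)).add hz0)
    rw [← gForm_self, heig u, hone] at h2
    refine (h2.congr fun n => ?_).trans (by ring_nf; rfl)
    simp only [map_sub, LinearMap.sub_apply, gForm_symm _ u (us _), hus _ (us _), h1, gForm_self]
    ring
  have hN : Tendsto (fun n => R.normSq θ (zs (ψ n)) (us (ψ n) - u)) atTop (𝓝 0) := by
    have h2 : Tendsto (fun n => R.gForm (zs (ψ n)) (us (ψ n) - u) (us (ψ n) - u) +
        M * R.bForm (zs (ψ n)) (us (ψ n) - u) (us (ψ n) - u)) atTop (𝓝 0) := by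
      simpa using hgu.add (hQ'.const_mul M)
    refine squeeze_zero (fun n => h.normSq_nonneg (hrV (hball _)) _) (fun n => ?_) h2
    rw [normSq_eq]
    have hb := (hR.exists_compactFormPair (h.subset (hrV (hball (φ n))))).choose_spec.b_nonneg
      (us (ψ n) - u)
    have := mul_le_mul_of_nonneg_right (hM _ (hrV (hball (φ n)))) hb
    linarith
  have hNx : Tendsto (fun n => R.normSq θ x (us (ψ n) - u)) atTop (𝓝 0) :=
    squeeze_zero (fun n => h.normSq_nonneg h.mem _) (fun n => (hCV _ (hrV (hball (φ n))) _).2)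
      (by simpa using hN.const_mul C)
  refine ⟨ψ, u, hψm, ⟨?_, hNx⟩, heig⟩
  have hz : Tendsto (fun n => ‖x - zs (ψ n)‖) atTop (𝓝 0) := by
    simpa using (tendsto_const_nhds.sub hzψ : Tendsto (fun n => x - zs (ψ n)) _ (𝓝 (x - x))).norm
  have h2 : Tendsto (fun n => R.bForm (zs (ψ n)) (us (ψ n) - u) (us (ψ n) - u) +
      L * ‖x - zs (ψ n)‖ * R.normSq θ x (us (ψ n) - u)) atTop (𝓝 0) := by
    simpa using hQ'.add ((hz.const_mul L).mul hNx)
  refine squeeze_zero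
    (fun n => (hR.exists_compactFormPair (h.subset h.mem)).choose_spec.b_nonneg _) (fun n => ?_) h2
  have := (abs_le.1 (hLip x (Metric.mem_ball_self hr) _ (hball (φ n)) (us (ψ n) - u)).1).2
  simp only [Function.comp_apply]
  linarith

/-- Orthonormal families of eigenvectors at parameters tending to `x` have a subsequence that
converges strongly to such a family at `x`. -/
theorem exists_subseq_eigenFamily (hR : R.StandingAssumptions Ω) (hH : ¬ FiniteDimensional ℝ R.H)
    (h : R.LocalAssumptions Ω V θ x) {zs : ℕ → X} (hzs : Tendsto zs atTop (𝓝 x)) {m : ℕ}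
    {ws : ℕ → ℕ → R.H}
    (hws : ∀ n, IsEigenFamily (R.bForm (zs n)) (R.gForm (zs n)) m (ws n)) :
    ∃ (φ : ℕ → ℕ) (w : ℕ → R.H), StrictMono φ ∧ IsEigenFamily (R.bForm x) (R.gForm x) m w ∧
      ∀ i < m, R.StronglyTendsto θ x (fun n => ws (φ n) i) (w i) := by
  have hlam : ∀ (φ : ℕ → ℕ), StrictMono φ → ∀ k, Tendsto
      (fun n => minMax (R.bForm (zs (φ n))) (R.gForm (zs (φ n))) (k + 1)) atTop
      (𝓝 (minMax (R.bForm x) (R.gForm x) (k + 1))) := fun φ hφ k =>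
    (hR.continuousAt_minMax hH (h.subset h.mem) k).tendsto.comp (hzs.comp hφ.tendsto_atTop)
  obtain ⟨φ, hφ, hP⟩ := exists_common_subseq (m := m)
    (fun i φ => ∃ u, R.StronglyTendsto θ x (fun n => ws (φ n) i) u ∧
      ∀ v, R.gForm x u v = minMax (R.bForm x) (R.gForm x) (i + 1) * R.bForm x u v)
    (fun i φ ψ ⟨u, hu, hu'⟩ hψ => ⟨u, hu.comp hψ, hu'⟩)
    (fun i hi φ hφ => by
      obtain ⟨ψ, u, hψ, hu, hu'⟩ := hR.exists_subseq_eigenvector h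
        (hzs.comp hφ.tendsto_atTop) (us := fun n => ws (φ n) i) (hlam φ hφ i)
        (fun n => by simpa using (hws (φ n)).ortho i hi i hi) (fun n => (hws (φ n)).eigen i hi)
      exact ⟨ψ, hψ, u, hu, hu'⟩)
  choose! w hw using hP
  refine ⟨φ, w, hφ, ⟨fun i hi => (hw i hi).2, fun i hi j hj => ?_⟩, fun i hi => (hw i hi).1⟩
  refine tendsto_nhds_unique (hR.tendsto_bForm h (hzs.comp hφ.tendsto_atTop)
    (hw i hi).1 (hw j hj).1) ?_
  simp only [Function.comp_apply, (hws _).ortho i hi j hj]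
  exact tendsto_const_nhds

end StandingAssumptions

end RayleighPair

namespace RayleighPair

/-! ### Families of eigenvectors and first-order expansions -/

section Families

variable {X Y : Type*} [AddCommGroup Y] [Module ℝ Y] {R : RayleighPair X Y} {x : X}

theorem isEigenFamily_of_mem {N : ℕ} {u : Fin N → R.H} (hu : u ∈ R.orthonormalFamilies N x) :
    IsEigenFamily (R.bForm x) (R.gForm x) N (fun i => if hi : i < N then u ⟨i, hi⟩ else 0) where
  eigen i hi := by
    simp only [hi, dif_pos, ← eigenvalue_eq]
    exact mem_eigenspace_iff.1 (hu.1 ⟨i, hi⟩)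
  ortho i hi j hj := by
    simp only [hi, hj, dif_pos, bForm_apply, hu.2, Fin.mk.injEq]

theorem mem_orthonormalFamilies {N m : ℕ} (hNm : N ≤ m) {w : ℕ → R.H}
    (hw : IsEigenFamily (R.bForm x) (R.gForm x) m w) :
    (fun i : Fin N => w i) ∈ R.orthonormalFamilies N x := by
  refine ⟨fun i => mem_eigenspace_iff.2 fun v => ?_, fun i j => ?_⟩
  · rw [eigenvalue_eq]
    exact hw.eigen i (by omega) v
  · rw [← bForm_apply, hw.ortho i (by omega) j (by omega)]
    simp [Fin.ext_iff]

theorem clm_pi_apply_eq_sum {N : ℕ} (T : (Fin N → ℝ) →L[ℝ] ℝ) (e : Fin N → ℝ) :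
    T e = ∑ i, T (Pi.single i 1) * e i := by
  conv_lhs => rw [← Finset.univ_sum_single e, map_sum]
  refine Finset.sum_congr rfl fun i _ => ?_
  rw [show (Pi.single i (e i) : Fin N → ℝ) = e i • Pi.single i 1 by
    rw [← Pi.single_smul, smul_eq_mul, mul_one], map_smul, smul_eq_mul, mul_comm]

theorem weight_succ {N : ℕ} (F : (Fin N → ℝ) → ℝ) (i : Fin N) (x : X) :
    R.weight F (i + 1) x = fderiv ℝ F (R.eigenvalueVec N x) (Pi.single i 1) := by
  rw [weight, dif_pos ⟨by omega, by omega⟩]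
  rfl

theorem weight_eq_zero {N : ℕ} (F : (Fin N → ℝ) → ℝ) {k : ℕ} (hk : N < k) (x : X) :
    R.weight F k x = 0 := by
  rw [weight, dif_neg (by omega)]

end Families

variable {X Y : Type*} [NormedAddCommGroup X] [NormedSpace ℝ X] [AddCommGroup Y] [Module ℝ Y]
variable {R : RayleighPair X Y} {Ω V : Set X} {θ : X → ℝ} {x : X}

namespace StandingAssumptions

/-- First variation: testing the eigenvalue equation at `zs n` with an eigenvector `v` at `x`. -/
theorem first_variation (hR : R.StandingAssumptions Ω) (h : R.LocalAssumptions Ω V θ x)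
    (hx : x ∈ Ω) {zs : ℕ → X} (hzs : Tendsto zs atTop (𝓝 x)) {ws : ℕ → R.H} {w v : R.H}
    (hw : R.StronglyTendsto θ x ws w) {ls : ℕ → ℝ} {l : ℝ}
    (hws : ∀ n u, R.gForm (zs n) (ws n) u = ls n * R.bForm (zs n) (ws n) u)
    (hv : ∀ u, R.gForm x v u = l * R.bForm x v u) :
    (fun n => (ls n - l) * R.bForm (zs n) (ws n) v - hR.derivForm hx l w v (zs n - x))
      =o[atTop] fun n => zs n - x := by
  obtain ⟨r, hr, hrV⟩ := Metric.mem_nhds_iff.1 h.nhds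
  have hmvt : ∀ n, ∃ ξ ∈ segment ℝ x (zs n), zs n ∈ Metric.ball x r →
      (ls n - l) * R.bForm (zs n) (ws n) v =
        (R.Gamx ξ (ws n) v - l • R.Bx ξ (ws n) v) (zs n - x) := by
    intro n
    by_cases hn : zs n ∈ Metric.ball x r
    · obtain ⟨ξ, hξ, heq⟩ := domain_mvt
        (fun y hy =>
          (hR.hasFDerivAt_gForm_sub_bForm (h.subset (hrV hy)) l (ws n) v).hasFDerivWithinAt)
        (convex_ball x r) (Metric.mem_ball_self hr) hn
      refine ⟨ξ, hξ, fun _ => ?_⟩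
      rw [← heq, hws, gForm_symm x, hv, bForm_symm x v]
      ring
    · exact ⟨x, left_mem_segment ℝ x _, fun hn' => absurd hn' hn⟩
  choose ξ hξ heq using hmvt
  have hz0 : Tendsto (fun n => ‖zs n - x‖) atTop (𝓝 0) := tendsto_iff_norm_sub_tendsto_zero.1 hzs
  have hξx : Tendsto ξ atTop (𝓝 x) := tendsto_iff_norm_sub_tendsto_zero.2
    (squeeze_zero (fun _ => norm_nonneg _) (fun n => norm_sub_le_of_mem_segment (hξ n)) hz0)
  have hlim := hR.tendsto_deriv h hξx hw (stronglyTendsto_const v)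
    (tendsto_const_nhds (x := l))
  rw [← hR.derivForm_apply hx, tendsto_iff_norm_sub_tendsto_zero] at hlim
  refine Asymptotics.isLittleO_iff.2 fun c hc => ?_
  filter_upwards [hzs.eventually (Metric.ball_mem_nhds x hr), hlim.eventually (gt_mem_nhds hc)]
    with n hn hnc
  rw [heq n hn, ← sub_apply]
  exact (ContinuousLinearMap.le_opNorm _ _).trans
    (mul_le_mul_of_nonneg_right hnc.le (norm_nonneg _))

theorem eigenvalue_expansion (hR : R.StandingAssumptions Ω) (h : R.LocalAssumptions Ω V θ x)
    (hx : x ∈ Ω) {zs : ℕ → X} (hzs : Tendsto zs atTop (𝓝 x)) {ws : ℕ → R.H} {w : R.H}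
    (hw : R.StronglyTendsto θ x ws w) {ls : ℕ → ℝ} {l : ℝ}
    (hws : ∀ n u, R.gForm (zs n) (ws n) u = ls n * R.bForm (zs n) (ws n) u)
    (hwl : ∀ u, R.gForm x w u = l * R.bForm x w u) (h1 : R.bForm x w w = 1) :
    (fun n => ls n - l - R.quotx x w (zs n - x)) =o[atTop] fun n => zs n - x := by
  have hfv := hR.first_variation h hx hzs hw hws hwl
  rw [hR.quotx_eq hx h1 (by rw [hwl, h1, mul_one])]
  have hβ : Tendsto (fun n => R.bForm (zs n) (ws n) w) atTop (𝓝 1) := by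
    rw [← h1]
    exact hR.tendsto_bForm h hzs hw (stronglyTendsto_const w)
  have hO : (fun n => (ls n - l) * R.bForm (zs n) (ws n) w) =O[atTop] fun n => ‖zs n - x‖ := by
    have h2 := hfv.isBigO.add ((hR.derivForm hx l w w).isBigO_comp (fun n => zs n - x) atTop)
    simpa using h2.norm_right
  have ho : (fun n => (R.bForm (zs n) (ws n) w)⁻¹ - 1) =o[atTop] fun _ => (1 : ℝ) := by
    rw [Asymptotics.isLittleO_one_iff]
    simpa using (hβ.inv₀ one_ne_zero).sub_const 1
  have hprod := hO.mul_isLittleO ho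
  simp only [mul_one] at hprod
  refine (hfv.add hprod.of_norm_right).congr' ?_ .rfl
  filter_upwards [hβ.eventually_ne one_ne_zero] with n hn
  field_simp
  ring

variable {N : ℕ} {F : (Fin N → ℝ) → ℝ}

theorem continuousAt_eigenvalueVec (hR : R.StandingAssumptions Ω) (hH : ¬ FiniteDimensional ℝ R.H)
    (hx : x ∈ Ω) (N : ℕ) : ContinuousAt (R.eigenvalueVec N) x := by
  refine continuousAt_pi.2 fun i => ?_
  simp only [eigenvalueVec, eigenvalue_eq]
  exact hR.continuousAt_minMax hH hx i

/-- First-order expansion of `F(λ₁, …, λ_N)` along a sequence of parameters for which the families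
of eigenvectors converge. -/
theorem combination_expansion (hR : R.StandingAssumptions Ω) (hH : ¬ FiniteDimensional ℝ R.H)
    (h : R.LocalAssumptions Ω V θ x) (hF : ContDiff ℝ 1 F) {zs : ℕ → X}
    (hzs : Tendsto zs atTop (𝓝 x)) {ws : ℕ → ℕ → R.H} {w : ℕ → R.H}
    (hws : ∀ n, IsEigenFamily (R.bForm (zs n)) (R.gForm (zs n)) N (ws n))
    (hw : IsEigenFamily (R.bForm x) (R.gForm x) N w)
    (hconv : ∀ i < N, R.StronglyTendsto θ x (fun n => ws n i) (w i)) :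
    (fun n => R.combination F (zs n) - R.combination F x -
      (∑ i : Fin N, R.weight F (i + 1) x • R.quotx x (w i)) (zs n - x))
      =o[atTop] fun n => zs n - x := by
  have hx := h.subset h.mem
  have hlam : ∀ i : Fin N, (fun n => R.eigenvalueVec N (zs n) i - R.eigenvalueVec N x i -
      R.quotx x (w i) (zs n - x)) =o[atTop] fun n => zs n - x := fun i => by
    simp only [eigenvalueVec, eigenvalue_eq]
    exact hR.eigenvalue_expansion h hx hzs (hconv i i.2) (fun n => (hws n).eigen i i.2)
      (hw.eigen i i.2) (by simpa using hw.ortho i i.2 i i.2)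
  have hO : (fun n => R.eigenvalueVec N (zs n) - R.eigenvalueVec N x) =O[atTop]
      fun n => zs n - x := Asymptotics.isBigO_pi.2 fun i => by
    simpa using (hlam i).isBigO.add ((R.quotx x (w i)).isBigO_comp (fun n => zs n - x) atTop)
  have hd : HasFDerivAt F (fderiv ℝ F (R.eigenvalueVec N x)) (R.eigenvalueVec N x) :=
    (hF.differentiable one_ne_zero _).hasFDerivAt
  have h1 := (hd.isLittleO.comp_tendsto
    ((hR.continuousAt_eigenvalueVec hH hx N).tendsto.comp hzs)).trans_isBigO hO
  have h2 : (fun n => ∑ i : Fin N, R.weight F (i + 1) x * (R.eigenvalueVec N (zs n) i -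
      R.eigenvalueVec N x i - R.quotx x (w i) (zs n - x))) =o[atTop] fun n => zs n - x :=
    Asymptotics.IsLittleO.fun_sum fun i _ => (hlam i).const_mul_left _
  refine (h1.add h2).congr_left fun n => ?_
  simp only [Function.comp_apply, combination]
  rw [clm_pi_apply_eq_sum, sum_apply]
  simp only [← weight_succ, smul_apply, smul_eq_mul, mul_sub,
    Finset.sum_sub_distrib, Pi.sub_apply]
  ring

theorem continuousAt_combination (hR : R.StandingAssumptions Ω) (hH : ¬ FiniteDimensional ℝ R.H)
    (hx : x ∈ Ω) (hF : ContDiff ℝ 1 F) : ContinuousAt (R.combination F) x :=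
  hF.continuous.continuousAt.comp (hR.continuousAt_eigenvalueVec hH hx N)

theorem continuousAt_weight (hR : R.StandingAssumptions Ω) (hH : ¬ FiniteDimensional ℝ R.H)
    (hx : x ∈ Ω) (hF : ContDiff ℝ 1 F) (i : Fin N) : ContinuousAt (R.weight F (i + 1)) x := by
  have : R.weight F (i + 1) = fun z => fderiv ℝ F (R.eigenvalueVec N z) (Pi.single i 1) :=
    funext fun z => weight_succ F i z
  rw [this]
  exact ((hF.continuous_fderiv one_ne_zero).continuousAt.comp
    (hR.continuousAt_eigenvalueVec hH hx N)).clm_apply continuousAt_const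

/-- If `u` is a normalized eigenvector, the derivative of the quotient depends on `u` through the
derivatives of the two forms only, and it passes to strong limits. -/
theorem tendsto_quotx (hR : R.StandingAssumptions Ω) (hH : ¬ FiniteDimensional ℝ R.H)
    (h : R.LocalAssumptions Ω V θ x) {zs : ℕ → X} (hzs : Tendsto zs atTop (𝓝 x))
    (hzΩ : ∀ n, zs n ∈ Ω) {m : ℕ} {ws : ℕ → ℕ → R.H} {w : ℕ → R.H}
    (hws : ∀ n, IsEigenFamily (R.bForm (zs n)) (R.gForm (zs n)) m (ws n))
    (hw : IsEigenFamily (R.bForm x) (R.gForm x) m w) {i : ℕ} (hi : i < m)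
    (hconv : R.StronglyTendsto θ x (fun n => ws n i) (w i)) :
    Tendsto (fun n => R.quotx (zs n) (ws n i)) atTop (𝓝 (R.quotx x (w i))) := by
  have hx := h.subset h.mem
  have h1 : ∀ {z : X} {u : ℕ → R.H} (_ : z ∈ Ω), IsEigenFamily (R.bForm z) (R.gForm z) m u →
      R.quotx z (u i) = R.Gamx z (u i) (u i) -
        minMax (R.bForm z) (R.gForm z) (i + 1) • R.Bx z (u i) (u i) := fun hz hu => by
    have h2 := hu.ortho i hi i hi
    rw [if_pos rfl] at h2
    rw [hR.quotx_eq hz h2 (by rw [hu.eigen i hi, h2, mul_one]), hR.derivForm_apply]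
  rw [h1 hx hw]
  refine (hR.tendsto_deriv h hzs hconv hconv
    ((hR.continuousAt_minMax hH hx i).tendsto.comp hzs)).congr fun n => ?_
  rw [h1 (hzΩ n) (hws n)]
  rfl

end StandingAssumptions

end RayleighPair

/-! ### Clarke differentials -/

section Clarke

variable {X : Type*} [NormedAddCommGroup X] [NormedSpace ℝ X] {f : X → ℝ} {x : X}

theorem map_shift_nhds_prod (x h : X) :
    map (fun p : X × ℝ => (p.1 + p.2 • h, p.2)) (𝓝 x ×ˢ 𝓝[>] (0 : ℝ)) = 𝓝 x ×ˢ 𝓝[>] (0 : ℝ) := by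
  have key : ∀ h : X, map (fun p : X × ℝ => (p.1 + p.2 • h, p.2)) (𝓝 x ×ˢ 𝓝[>] (0 : ℝ)) ≤
      𝓝 x ×ˢ 𝓝[>] (0 : ℝ) := fun h => by
    refine Tendsto.prodMk ?_ tendsto_snd
    have h1 : Tendsto (fun p : X × ℝ => p.2) (𝓝 x ×ˢ 𝓝[>] (0 : ℝ)) (𝓝 0) :=
      tendsto_snd.mono_right nhdsWithin_le_nhds
    simpa using tendsto_fst.add (h1.smul_const h)
  refine le_antisymm (key h) ?_
  have h2 := map_mono (m := fun p : X × ℝ => (p.1 + p.2 • h, p.2)) (key (-h))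
  rw [map_map] at h2
  convert h2 using 1
  conv_lhs => rw [← map_id (f := 𝓝 x ×ˢ 𝓝[>] (0 : ℝ))]
  congr 1
  ext p <;> simp

theorem clarkeLower_eq_neg (f : X → ℝ) (x h : X) : clarkeLower f x h = -clarkeUpper f x (-h) := by
  rw [clarkeUpper, ← map_shift_nhds_prod x h, ← limsup_comp, clarkeLower, ← neg_eq_iff_eq_neg,
    ← EReal.limsup_neg]
  congr 1
  ext p
  simp only [Pi.neg_apply, Function.comp_apply, ← EReal.coe_neg]
  congr 1
  simp only [smul_neg, add_neg_cancel_right]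
  ring

/-- The sub- and the superdifferential of Clarke always coincide. -/
theorem clarkeSuperdiff_eq_clarkeSubdiff (f : X → ℝ) (x : X) :
    clarkeSuperdiff f x = clarkeSubdiff f x := by
  ext ζ
  simp only [clarkeSuperdiff, clarkeSubdiff, Set.mem_ofPred_eq, clarkeLower_eq_neg]
  constructor
  · intro h v
    have := h (-v)
    rwa [neg_neg, map_neg, EReal.coe_neg, EReal.neg_le_neg_iff] at this
  · intro h v
    have := h (-v)
    rw [map_neg, EReal.coe_neg] at this
    exact EReal.neg_le.1 this

theorem convex_clarkeSubdiff (f : X → ℝ) (x : X) : Convex ℝ (clarkeSubdiff f x) := by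
  have : clarkeSubdiff f x =
      ⋂ h : X, {ζ : X →L[ℝ] ℝ | ((ζ h : ℝ) : EReal) ≤ clarkeUpper f x h} := by
    ext ζ
    simp [clarkeSubdiff]
  rw [this]
  refine convex_iInter fun h => ?_
  have hl : IsLowerSet {r : ℝ | (r : EReal) ≤ clarkeUpper f x h} := fun a b hab ha =>
    (EReal.coe_le_coe_iff.2 hab).trans ha
  exact hl.ordConnected.convex.linear_preimage (ContinuousLinearMap.apply ℝ ℝ h).toLinearMap

/-- A mean value inequality: a bound of the lower right derivatives in the direction `h` near `x`
bounds the generalized directional derivative. -/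
theorem clarkeUpper_le {h : X} {c c' : ℝ} (hc : c < c') (hcont : ∀ᶠ z in 𝓝 x, ContinuousAt f z)
    (hder : ∀ᶠ z in 𝓝 x, ∀ r, c < r → ∃ᶠ t in 𝓝[>] (0 : ℝ), (f (z + t • h) - f z) / t < r) :
    clarkeUpper f x h ≤ c' := by
  obtain ⟨ρ, hρ, hball⟩ := Metric.eventually_nhds_iff_ball.1 (hcont.and hder)
  have h1 : ∀ᶠ p : X × ℝ in 𝓝 x ×ˢ 𝓝[>] (0 : ℝ), p.1 ∈ Metric.ball x ρ :=
    tendsto_fst.eventually (Metric.ball_mem_nhds x hρ)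
  have h2 : ∀ᶠ p : X × ℝ in 𝓝 x ×ˢ 𝓝[>] (0 : ℝ), p.1 + p.2 • h ∈ Metric.ball x ρ := by
    have := h1
    rwa [← map_shift_nhds_prod x h, eventually_map] at this
  have h3 : ∀ᶠ p : X × ℝ in 𝓝 x ×ˢ 𝓝[>] (0 : ℝ), 0 < p.2 :=
    tendsto_snd.eventually self_mem_nhdsWithin
  refine limsup_le_of_le (h := ?_)
  filter_upwards [h1, h2, h3] with p hp1 hp2 hp3
  rw [EReal.coe_le_coe_iff, div_le_iff₀ hp3]
  have hmem : ∀ s ∈ Set.Icc 0 p.2, p.1 + s • h ∈ Metric.ball x ρ := fun s hs => by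
    have := (convex_ball x ρ) hp1 hp2 (a := 1 - s / p.2) (b := s / p.2)
      (by rw [sub_nonneg, div_le_one hp3]; exact hs.2) (div_nonneg hs.1 hp3.le) (by ring)
    convert this using 1
    rw [smul_add, smul_smul, div_mul_cancel₀ _ hp3.ne', ← add_assoc, ← add_smul]
    simp
  have key := image_le_of_liminf_slope_right_lt_deriv_boundary
    (f := fun s : ℝ => f (p.1 + s • h)) (f' := fun _ => c) (a := 0) (b := p.2)
    (B := fun s => f p.1 + c' * s) (B' := fun _ => c') ?_ ?_ (by simp) ?_ (fun _ _ _ => hc)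
    (Set.right_mem_Icc.2 hp3.le)
  · linarith
  · intro s hs
    refine ContinuousAt.continuousWithinAt (ContinuousAt.comp (f := fun s : ℝ => p.1 + s • h)
      (hball _ (hmem s hs)).1 ?_)
    fun_prop
  · intro s hs r hr
    have h4 := (hball _ (hmem s ⟨hs.1, hs.2.le⟩)).2 r hr
    have h5 : map (fun t : ℝ => s + t) (𝓝[>] 0) = 𝓝[>] s := by
      simp
    rw [← h5, frequently_map]
    refine h4.mono fun t ht => ?_
    rw [slope_def_field, add_sub_cancel_left, add_smul, ← add_assoc]
    exact ht
  · intro s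
    simpa using ((hasDerivAt_id s).const_mul c').const_add (f p.1)

theorem le_clarkeUpper {h : X} {L : ℝ} {t : ℕ → ℝ} (ht : Tendsto t atTop (𝓝[>] 0))
    (hL : Tendsto (fun n => (f (x + t n • h) - f x) / t n) atTop (𝓝 L)) :
    (L : EReal) ≤ clarkeUpper f x h := by
  have h1 : Tendsto (fun n => (x, t n)) atTop (𝓝 x ×ˢ 𝓝[>] (0 : ℝ)) :=
    tendsto_const_nhds.prodMk ht
  have h2 := ((continuous_coe_real_ereal.tendsto L).comp hL).limsup_eq
  rw [← h2]
  exact (limsup_comp (fun p : X × ℝ => (((f (p.1 + p.2 • h) - f p.1) / p.2 : ℝ) : EReal))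
    (fun n => (x, t n)) atTop).trans_le (limsup_le_limsup_of_le h1)

theorem clarkeLower_le {h : X} {L : ℝ} {t : ℕ → ℝ} (ht : Tendsto t atTop (𝓝[>] 0))
    (hL : Tendsto (fun n => (f (x + t n • h) - f x) / t n) atTop (𝓝 L)) :
    clarkeLower f x h ≤ (L : EReal) := by
  have h1 : Tendsto (fun n => (x, t n)) atTop (𝓝 x ×ˢ 𝓝[>] (0 : ℝ)) :=
    tendsto_const_nhds.prodMk ht
  have h2 := ((continuous_coe_real_ereal.tendsto L).comp hL).liminf_eq
  rw [← h2]
  exact (liminf_le_liminf_of_le h1).trans_eq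
    (liminf_comp (fun p : X × ℝ => (((f (p.1 + p.2 • h) - f p.1) / p.2 : ℝ) : EReal))
      (fun n => (x, t n)) atTop).symm

end Clarke

/-! ### Convex hulls, separation and weighted sums -/

/-- The convex hull of a compact subset of a finite-dimensional subspace is compact: by the theorem
of Carathéodory it is a finite union of images of products of a simplex and of copies of the set. -/
theorem IsCompact.convexHull_of_subset_finiteDimensional {E : Type*} [AddCommGroup E] [Module ℝ E]
    [TopologicalSpace E] [IsTopologicalAddGroup E] [ContinuousSMul ℝ E] {K : Set E}
    (hK : IsCompact K) {W : Submodule ℝ E} [FiniteDimensional ℝ W] (hKW : K ⊆ W) :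
    IsCompact (convexHull ℝ K) := by
  let Φ : ∀ n : ℕ, (Fin n → ℝ) × (Fin n → E) → E := fun n p => ∑ i, p.1 i • p.2 i
  have hΦ : ∀ n, Continuous (Φ n) := fun n => by fun_prop
  have heq : convexHull ℝ K = ⋃ n ∈ Finset.range (Module.finrank ℝ W + 2),
      Φ n '' (stdSimplex ℝ (Fin n) ×ˢ Set.univ.pi fun _ => K) := by
    ext y
    simp only [Set.mem_iUnion, Set.mem_image, Set.mem_prod, Set.mem_univ_pi, Prod.exists]
    constructor
    · intro hy
      obtain ⟨ι, _, z, w, hz, hai, hw, hw1, rfl⟩ := eq_pos_convex_span_of_mem_convexHull hy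
      have hcard : Fintype.card ι ≤ Module.finrank ℝ W + 1 := by
        refine hai.card_le_finrank_succ.trans (Nat.succ_le_succ (Submodule.finrank_mono ?_))
        rw [vectorSpan_def, Submodule.span_le]
        rintro _ ⟨a, ⟨i, rfl⟩, b, ⟨j, rfl⟩, rfl⟩
        exact W.sub_mem (hKW (hz ⟨i, rfl⟩)) (hKW (hz ⟨j, rfl⟩))
      let e := (Fintype.equivFin ι).symm
      refine ⟨Fintype.card ι, Finset.mem_range.2 (by omega), w ∘ e, z ∘ e,
        ⟨⟨fun i => (hw _).le, ?_⟩, fun i => hz ⟨_, rfl⟩⟩, ?_⟩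
      · rw [← hw1]
        exact e.sum_comp w
      · exact e.sum_comp fun i => w i • z i
    · rintro ⟨n, -, w, z, ⟨⟨hw0, hw1⟩, hz⟩, rfl⟩
      exact (convex_convexHull ℝ K).sum_mem (fun i _ => hw0 i) hw1
        fun i _ => subset_convexHull ℝ K (hz i)
  rw [heq]
  exact (Finset.range _).isCompact_biUnion fun n _ =>
    ((isCompact_stdSimplex ℝ (Fin n)).prod (isCompact_univ_pi fun _ => hK)).image (hΦ n)

/-- A functional outside a norm compact convex set of functionals is separated from it by the
evaluation at a vector. -/
theorem exists_eval_separation {X : Type*} [NormedAddCommGroup X] [NormedSpace ℝ X]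
    {K : Set (X →L[ℝ] ℝ)} (hK : IsCompact K) (hconv : Convex ℝ K) {ζ : X →L[ℝ] ℝ} (hζ : ζ ∉ K) :
    ∃ (h : X) (c : ℝ), (∀ ξ ∈ K, ξ h < c) ∧ c < ζ h := by
  let P := topDualPairing ℝ X
  let T : (X →L[ℝ] ℝ) →ₗ[ℝ] WeakBilin P := LinearMap.id (R := ℝ) (M := X →L[ℝ] ℝ)
  have hTc : Continuous T := WeakBilin.continuous_of_continuous_eval P fun y =>
    (ContinuousLinearMap.apply ℝ ℝ y).continuous
  have hT2 : T2Space (WeakBilin P) :=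
    (WeakBilin.isEmbedding ContinuousLinearMap.coe_injective).t2Space
  have hTK : T ζ ∉ T '' K := by
    rintro ⟨ξ, hξ, hξζ⟩
    have : ξ = ζ := hξζ
    exact hζ (this ▸ hξ)
  obtain ⟨φ, c, h1, h2⟩ := geometric_hahn_banach_closed_point (hconv.linear_image T)
    (hK.image hTc).isClosed hTK
  obtain ⟨h, rfl⟩ := LinearMap.dualEmbedding_surjective P φ
  exact ⟨h, c, fun ξ hξ => h1 _ ⟨ξ, hξ, rfl⟩, h2⟩

/-- Comparison of two weighted sums, class by class for the fibers of `l`. -/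
theorem sum_weight_mul_le {N : ℕ} {d a b l : ℕ → ℝ}
    (h : ∀ y, (∀ i < N, l i = y → d i * a i ≤ d i * b i) ∨
      ((∀ i < N, ∀ j < N, l i = y → l j = y → d i = d j) ∧
        ∑ i ∈ Finset.range N with l i = y, a i = ∑ i ∈ Finset.range N with l i = y, b i)) :
    ∑ i ∈ Finset.range N, d i * a i ≤ ∑ i ∈ Finset.range N, d i * b i := by
  have hm : ∀ i ∈ Finset.range N, l i ∈ (Finset.range N).image l := fun i hi =>
    Finset.mem_image_of_mem l hi
  rw [← Finset.sum_fiberwise_of_maps_to hm,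
    ← Finset.sum_fiberwise_of_maps_to hm (fun i => d i * b i)]
  refine Finset.sum_le_sum fun y hy => ?_
  obtain ⟨k, hk, hky⟩ := Finset.mem_image.1 hy
  rcases h y with h | ⟨h, hs⟩
  · refine Finset.sum_le_sum fun i hi => ?_
    rw [Finset.mem_filter, Finset.mem_range] at hi
    exact h i hi.1 hi.2
  · have hd : ∀ c : ℕ → ℝ, ∑ i ∈ Finset.range N with l i = y, d i * c i =
        d k * ∑ i ∈ Finset.range N with l i = y, c i := fun c => by
      rw [Finset.mul_sum]
      refine Finset.sum_congr rfl fun i hi => ?_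
      rw [Finset.mem_filter, Finset.mem_range] at hi
      rw [h i hi.1 k (Finset.mem_range.1 hk) hi.2 hky]
    rw [hd, hd, hs]

/-! ### Expansion of eigenvectors and comparison of traces -/

namespace CompactFormPair

variable {E : Type*} [AddCommGroup E] [Module ℝ E] {b g : LinearMap.BilinForm ℝ E} {θ : ℝ}

/-- The eigenvalues up to a level `c` are finite in number. -/
theorem exists_index_gap (h : CompactFormPair b g θ) (hE : ¬ FiniteDimensional ℝ E) (c : ℝ) :
    ∃ m, c < minMax b g (m + 1) ∧ ∀ i < m, minMax b g (i + 1) ≤ c := by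
  classical
  have hex := (h.spectral hE).2.1 c
  exact ⟨Nat.find hex, Nat.find_spec hex, fun i hi => not_lt.1 (Nat.find_min hex hi)⟩

/-- A cluster that ends before the index `N` is spanned by the corresponding members of any
eigenfamily of length `N`. -/
theorem eq_sum_cluster (h : CompactFormPair b g θ) (hE : ¬ FiniteDimensional ℝ E) {N : ℕ}
    {w : ℕ → E} (hw : IsEigenFamily b g N w) {y : ℝ}
    (hy : ∀ j, N ≤ j → minMax b g (j + 1) ≠ y) {u : E} (hu : ∀ v, g u v = y * b u v)
    {k : ℕ} (hk : k < N) (hky : minMax b g (k + 1) = y) :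
    u = ∑ j ∈ Finset.range N with minMax b g (j + 1) = y, b u (w j) • w j := by
  obtain ⟨m, hm, hmy⟩ := h.exists_index_gap hE y
  have hmono := (h.spectral hE).1
  have hmN : m ≤ N := by
    by_contra hlt
    refine hy N le_rfl (le_antisymm (hmy N (by omega)) ?_)
    rw [← hky]
    exact hmono _ _ hk.le
  have h1 := h.eq_sum_of_eigen hE (hw.mono hmN) hu (fun i hi => (hmy i hi).trans_lt hm) hm
  conv_lhs => rw [h1]
  rw [Finset.sum_filter]
  have hsub : Finset.range m ⊆ Finset.range N := Finset.range_mono hmN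
  rw [← Finset.sum_subset hsub]
  · refine Finset.sum_congr rfl fun i hi => ?_
    split_ifs with hiy
    · rfl
    · rw [h.apply_eq_zero_of_eigen hu
        (hw.eigen i (Finset.mem_range.1 (hsub hi))) (Ne.symm hiy), zero_smul]
  · intro i _ him
    rw [if_neg]
    intro hiy
    have := hmono m i (by simpa using him)
    linarith

end CompactFormPair

namespace RayleighPair

variable {X Y : Type*} [NormedAddCommGroup X] [NormedSpace ℝ X] [AddCommGroup Y] [Module ℝ Y]
variable {R : RayleighPair X Y} {Ω V : Set X} {θ : X → ℝ} {x : X}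

namespace StandingAssumptions

variable {N : ℕ} {F : (Fin N → ℝ) → ℝ}

theorem eigenvalue_mono (hR : R.StandingAssumptions Ω) (hH : ¬ FiniteDimensional ℝ R.H)
    (hx : x ∈ Ω) {i j : ℕ} (hij : i ≤ j) : R.eigenvalue (i + 1) x ≤ R.eigenvalue (j + 1) x := by
  obtain ⟨t, hp⟩ := hR.exists_compactFormPair hx
  rw [eigenvalue_eq, eigenvalue_eq]
  exact (hp.spectral hH).1 i j hij

theorem quotx_eigenFamily (hR : R.StandingAssumptions Ω) (hx : x ∈ Ω) {m : ℕ} {w : ℕ → R.H}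
    (hw : IsEigenFamily (R.bForm x) (R.gForm x) m w) {i : ℕ} (hi : i < m) :
    R.quotx x (w i) = hR.derivForm hx (R.eigenvalue (i + 1) x) (w i) (w i) := by
  have h2 := hw.ortho i hi i hi
  rw [if_pos rfl] at h2
  exact hR.quotx_eq hx h2 (by rw [hw.eigen i hi, h2, mul_one, eigenvalue_eq])

/-- The sum of the derivatives of the quotient over a cluster that ends before the index `N` does
not depend on the family: it is the trace of the derivative of the forms on an eigenspace. -/
theorem sum_quotx_cluster (hR : R.StandingAssumptions Ω) (hH : ¬ FiniteDimensional ℝ R.H)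
    (hx : x ∈ Ω) {u w : ℕ → R.H} (hu : IsEigenFamily (R.bForm x) (R.gForm x) N u)
    (hw : IsEigenFamily (R.bForm x) (R.gForm x) N w) {y : ℝ}
    (hy : ∀ j, N ≤ j → R.eigenvalue (j + 1) x ≠ y) :
    ∑ i ∈ Finset.range N with R.eigenvalue (i + 1) x = y, R.quotx x (u i) =
      ∑ i ∈ Finset.range N with R.eigenvalue (i + 1) x = y, R.quotx x (w i) := by
  obtain ⟨t, hp⟩ := hR.exists_compactFormPair hx
  have hq : ∀ {v : ℕ → R.H}, IsEigenFamily (R.bForm x) (R.gForm x) N v →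
      ∑ i ∈ Finset.range N with R.eigenvalue (i + 1) x = y, R.quotx x (v i) =
      ∑ i ∈ Finset.range N with R.eigenvalue (i + 1) x = y, hR.derivForm hx y (v i) (v i) :=
    fun hv => Finset.sum_congr rfl fun i hi => by
      rw [Finset.mem_filter, Finset.mem_range] at hi
      rw [hR.quotx_eigenFamily hx hv hi.1, hi.2]
  have hexp : ∀ {v v' : ℕ → R.H}, IsEigenFamily (R.bForm x) (R.gForm x) N v →
      IsEigenFamily (R.bForm x) (R.gForm x) N v' →
      ∀ i ∈ (Finset.range N).filter (fun i => R.eigenvalue (i + 1) x = y),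
        v i = ∑ j ∈ Finset.range N with R.eigenvalue (j + 1) x = y,
          R.bForm x (v i) (v' j) • v' j := fun {v v'} hv hv' i hi => by
    rw [Finset.mem_filter, Finset.mem_range] at hi
    simp only [eigenvalue_eq] at hy hi ⊢
    exact hp.eq_sum_cluster hH hv' hy (fun z => by rw [hv.eigen i hi.1, hi.2]) hi.1 hi.2
  rw [hq hu, hq hw]
  exact sum_apply_self_eq (bForm_symm x) _ (hexp hu hw) (hexp hw hu)

/-- Along a sequence `x + t h` with `t ↓ 0`, the families of eigenvectors converge
to a family that diagonalizes the derivatives of the forms on each cluster, with diagonal entries in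
increasing order, and that gives the derivative of `F(λ₁, …, λ_N)`. -/
theorem exists_directional (hR : R.StandingAssumptions Ω) (hH : ¬ FiniteDimensional ℝ R.H)
    (hx : x ∈ Ω) (hF : ContDiff ℝ 1 F) {m : ℕ} (hNm : N ≤ m) (h : X) :
    ∃ (t : ℕ → ℝ) (w : ℕ → R.H), Tendsto t atTop (𝓝[>] 0) ∧
      IsEigenFamily (R.bForm x) (R.gForm x) m w ∧
      Tendsto (fun n => (R.combination F (x + t n • h) - R.combination F x) / t n) atTop
        (𝓝 ((∑ i : Fin N, R.weight F (i + 1) x • R.quotx x (w i)) h)) ∧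
      ∀ i < m, ∀ j < m, R.eigenvalue (i + 1) x = R.eigenvalue (j + 1) x →
        (i ≤ j → R.quotx x (w i) h ≤ R.quotx x (w j) h) ∧
        (i ≠ j → hR.derivForm hx (R.eigenvalue (i + 1) x) (w i) (w j) h = 0) := by
  obtain ⟨V, θ, hloc⟩ := hR.loc x hx
  have ht0 : Tendsto (fun n : ℕ => 1 / ((n : ℝ) + 1)) atTop (𝓝[>] 0) :=
    tendsto_nhdsWithin_iff.2 ⟨tendsto_one_div_add_atTop_nhds_zero_nat,
      .of_forall fun n => by simp only [Set.mem_Ioi]; positivity⟩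
  have hz0 : Tendsto (fun t : ℝ => x + t • h) (𝓝[>] 0) (𝓝 x) := by
    have : Continuous fun t : ℝ => x + t • h := by fun_prop
    simpa using (this.tendsto 0).mono_left nhdsWithin_le_nhds
  obtain ⟨n₀, hn₀⟩ := eventually_atTop.1 ((hz0.comp ht0).eventually hloc.nhds)
  have hΩ : ∀ n : ℕ, x + (1 / (((n + n₀ : ℕ) : ℝ) + 1)) • h ∈ Ω := fun n =>
    hloc.subset (hn₀ _ (by omega))
  have hfam : ∀ n : ℕ, ∃ w, IsEigenFamily
      (R.bForm (x + (1 / (((n + n₀ : ℕ) : ℝ) + 1)) • h))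
      (R.gForm (x + (1 / (((n + n₀ : ℕ) : ℝ) + 1)) • h)) m w := fun n => by
    obtain ⟨t, hp⟩ := hR.exists_compactFormPair (hΩ n)
    obtain ⟨w, hw⟩ := (hp.spectral hH).2.2
    exact ⟨w, hw m⟩
  choose ws₀ hws₀ using hfam
  obtain ⟨φ, w, hφ, hw, hconv⟩ := hR.exists_subseq_eigenFamily hH hloc
    (hz0.comp (ht0.comp (tendsto_add_atTop_nat n₀))) hws₀
  set t : ℕ → ℝ := fun n => 1 / (((φ n + n₀ : ℕ) : ℝ) + 1) with ht
  set ws : ℕ → ℕ → R.H := fun n => ws₀ (φ n)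
  have htt : Tendsto t atTop (𝓝[>] 0) :=
    (ht0.comp (tendsto_add_atTop_nat n₀)).comp hφ.tendsto_atTop
  have hpos : ∀ n, 0 < t n := fun n => by simp only [ht]; positivity
  have hzs : Tendsto (fun n => x + t n • h) atTop (𝓝 x) := hz0.comp htt
  have hws : ∀ n, IsEigenFamily (R.bForm (x + t n • h)) (R.gForm (x + t n • h)) m (ws n) :=
    fun n => hws₀ (φ n)
  -- division by `t n` of an expansion along the sequence
  have hdiv : ∀ {a : ℕ → ℝ} {T : X →L[ℝ] ℝ},
      ((fun n => a n - T (x + t n • h - x)) =o[atTop] fun n => x + t n • h - x) →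
      Tendsto (fun n => a n / t n) atTop (𝓝 (T h)) := fun {a T} ha => by
    have h1 : (fun n => a n - t n * T h) =o[atTop] t := by
      simp only [add_sub_cancel_left, map_smul, smul_eq_mul] at ha
      exact ha.trans_isBigO (.of_bound ‖h‖ (.of_forall fun n => by rw [norm_smul, mul_comm]))
    have h2 := h1.tendsto_div_nhds_zero.add_const (T h)
    rw [zero_add] at h2
    refine h2.congr fun n => ?_
    have := (hpos n).ne'
    field_simp
    ring
  have hone : ∀ i < m, R.bForm x (w i) (w i) = 1 := fun i hi => by simpa using hw.ortho i hi i hi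
  have hder : ∀ i < m, Tendsto (fun n =>
      (R.eigenvalue (i + 1) (x + t n • h) - R.eigenvalue (i + 1) x) / t n) atTop
      (𝓝 (R.quotx x (w i) h)) := fun i hi => by
    refine hdiv ?_
    simp only [eigenvalue_eq]
    exact hR.eigenvalue_expansion hloc hx hzs (hconv i hi) (fun n => (hws n).eigen i hi)
      (hw.eigen i hi) (hone i hi)
  refine ⟨t, w, htt, hw, hdiv ?_, fun i hi j hj hij => ⟨fun hle => ?_, fun hne => ?_⟩⟩
  · exact hR.combination_expansion hH hloc hF hzs (fun n => (hws n).mono hNm) (hw.mono hNm)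
      fun i hi => hconv i (by omega)
  · refine le_of_tendsto_of_tendsto' (hder i hi) (hder j hj) fun n => ?_
    rw [hij]
    have := hR.eigenvalue_mono hH (x := x + t n • h) (hΩ (φ n)) hle
    have := (hpos n).le
    gcongr
  · have h1 := hR.first_variation hloc hx hzs (hconv i hi)
      (fun n => (hws n).eigen i hi) (v := w j) (l := R.eigenvalue (i + 1) x)
      (fun z => by rw [hij, eigenvalue_eq]; exact hw.eigen j hj z)
    have h2 := hdiv h1
    have h3 := (hder i hi).mul
      (hR.tendsto_bForm hloc hzs (hconv i hi) (stronglyTendsto_const (w j)))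
    rw [hw.ortho i hi j hj, if_neg hne, mul_zero] at h3
    refine tendsto_nhds_unique h2 (h3.congr fun n => ?_)
    rw [eigenvalue_eq (x := x + t n • h)]
    ring

end StandingAssumptions

end RayleighPair

/-! ### The set `C'` and the Clarke differentials of `F(λ₁, …, λ_N)` -/

namespace RayleighPair

variable {X Y : Type*} [NormedAddCommGroup X] [NormedSpace ℝ X] [AddCommGroup Y] [Module ℝ Y]
variable {R : RayleighPair X Y} {Ω V : Set X} {θ : X → ℝ} {x : X}

namespace StandingAssumptions

variable {N : ℕ} {F : (Fin N → ℝ) → ℝ}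

/-- In a family that diagonalizes the derivative of the forms in the direction `h`, the derivative
of the quotient at a normalized eigenvector is an average of those at the members of the family with
the same eigenvalue. -/
theorem exists_average (hR : R.StandingAssumptions Ω) (hx : x ∈ Ω) {m : ℕ} {w : ℕ → R.H}
    (hw : IsEigenFamily (R.bForm x) (R.gForm x) m w) {h : X}
    (hdiag : ∀ i < m, ∀ j < m, R.eigenvalue (i + 1) x = R.eigenvalue (j + 1) x → i ≠ j →
      hR.derivForm hx (R.eigenvalue (i + 1) x) (w i) (w j) h = 0)
    {l : ℝ} {u : R.H} (hu : ∀ v, R.gForm x u v = l * R.bForm x u v) (h1 : R.bForm x u u = 1)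
    (hexp : u = ∑ j ∈ Finset.range m, R.bForm x u (w j) • w j) :
    ∃ c : ℕ → ℝ, (∀ j, 0 ≤ c j) ∧ (∀ j < m, R.eigenvalue (j + 1) x ≠ l → c j = 0) ∧
      ∑ j ∈ Finset.range m, c j = 1 ∧
      R.quotx x u h = ∑ j ∈ Finset.range m, c j * R.quotx x (w j) h := by
  obtain ⟨t, hp⟩ := hR.exists_compactFormPair hx
  set a : ℕ → ℝ := fun j => R.bForm x u (w j) with ha
  have hzero : ∀ j < m, R.eigenvalue (j + 1) x ≠ l → a j = 0 := fun j hj hne =>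
    hp.apply_eq_zero_of_eigen hu (hw.eigen j hj) (by rw [← eigenvalue_eq]; exact hne.symm)
  refine ⟨fun j => a j ^ 2, fun j => sq_nonneg _,
    fun j hj hne => by simp [hzero j hj hne], ?_, ?_⟩
  · have h2 : R.bForm x u (∑ j ∈ Finset.range m, a j • w j) = 1 := by rw [← hexp, h1]
    rw [← h2, map_sum]
    refine Finset.sum_congr rfl fun j _ => ?_
    simp only [map_smul, smul_eq_mul, sq]
    rfl
  · rw [hR.quotx_eq hx h1 (by rw [hu, h1, mul_one])]
    conv_lhs => rw [hexp]
    simp only [map_sum, LinearMap.sum_apply, map_smul, LinearMap.smul_apply, sum_apply, smul_apply,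
      smul_eq_mul]
    refine Finset.sum_congr rfl fun j hj => ?_
    have hj' := Finset.mem_range.1 hj
    by_cases hjl : R.eigenvalue (j + 1) x = l
    · rw [Finset.sum_eq_single_of_mem j hj]
      · rw [hR.quotx_eigenFamily hx hw hj', hjl]
        ring
      · intro i hi hij
        have hi' := Finset.mem_range.1 hi
        by_cases hil : R.eigenvalue (i + 1) x = l
        · have := hdiag i hi' j hj' (hil.trans hjl.symm) hij
          rw [hil] at this
          rw [this, mul_zero]
        · rw [show R.bForm x u (w i) = a i from rfl, hzero i hi' hil, zero_mul]
    · rw [show R.bForm x u (w j) = a j from rfl, hzero j hj' hjl]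
      ring

/-- The functional `∑ d_k 𝓡_x(x,u_k)`, evaluated at `h`, as a sum over `range N`. -/
theorem sum_weight_apply (w : ℕ → R.H) (x h : X) :
    (∑ i : Fin N, R.weight F (i + 1) x • R.quotx x (w i)) h =
      ∑ i ∈ Finset.range N, R.weight F (i + 1) x * R.quotx x (w i) h := by
  rw [sum_apply, Finset.sum_range fun i => R.weight F (i + 1) x * R.quotx x (w i) h]
  rfl

/-- If the weights are constant on a cluster and do not vanish there, the cluster ends before the
index `N`, hence its contribution does not depend on the family. -/
theorem sum_quotx_of_const (hR : R.StandingAssumptions Ω) (hH : ¬ FiniteDimensional ℝ R.H)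
    (hx : x ∈ Ω) {u w : ℕ → R.H} (hu : IsEigenFamily (R.bForm x) (R.gForm x) N u)
    (hw : IsEigenFamily (R.bForm x) (R.gForm x) N w) {k : ℕ}
    (hd : R.weight F (k + 1) x ≠ 0) (hconst : R.ConstOnCluster F (k + 1) x) (h : X) :
    (∀ i < N, ∀ j < N, R.eigenvalue (i + 1) x = R.eigenvalue (k + 1) x →
      R.eigenvalue (j + 1) x = R.eigenvalue (k + 1) x →
      R.weight F (i + 1) x = R.weight F (j + 1) x) ∧
    ∑ i ∈ Finset.range N with R.eigenvalue (i + 1) x = R.eigenvalue (k + 1) x,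
        R.quotx x (u i) h =
      ∑ i ∈ Finset.range N with R.eigenvalue (i + 1) x = R.eigenvalue (k + 1) x,
        R.quotx x (w i) h := by
  refine ⟨fun i _ j _ hi hj => hconst _ ⟨by omega, hi⟩ _ ⟨by omega, hj⟩, ?_⟩
  have := congrArg (fun T : X →L[ℝ] ℝ => T h) (hR.sum_quotx_cluster hH hx hu hw
    (y := R.eigenvalue (k + 1) x) fun j hj hjk => hd (by
      rw [hconst (k + 1) ⟨by omega, rfl⟩ (j + 1) ⟨by omega, hjk⟩, weight_eq_zero F (by omega)]))
  simpa only [sum_apply] using this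

/-- Weighted sums of derivatives over two families compare if, for each nonzero weight, either the
weights are constant on the cluster or the corresponding terms compare. -/
theorem sum_weight_le (hR : R.StandingAssumptions Ω) (hH : ¬ FiniteDimensional ℝ R.H)
    (hx : x ∈ Ω) {u w : ℕ → R.H} (hu : IsEigenFamily (R.bForm x) (R.gForm x) N u)
    (hw : IsEigenFamily (R.bForm x) (R.gForm x) N w) {h : X}
    (hcmp : ∀ i < N, R.weight F (i + 1) x ≠ 0 →
      R.weight F (i + 1) x * R.quotx x (u i) h ≤ R.weight F (i + 1) x * R.quotx x (w i) h ∨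
        R.ConstOnCluster F (i + 1) x) :
    (∑ i : Fin N, R.weight F (i + 1) x • R.quotx x (u i)) h ≤
      (∑ i : Fin N, R.weight F (i + 1) x • R.quotx x (w i)) h := by
  rw [sum_weight_apply, sum_weight_apply]
  refine sum_weight_mul_le (l := fun i => R.eigenvalue (i + 1) x) fun y => ?_
  by_cases hy : ∃ k < N, R.eigenvalue (k + 1) x = y ∧ R.weight F (k + 1) x ≠ 0 ∧
      R.ConstOnCluster F (k + 1) x
  · obtain ⟨k, -, rfl, hd, hconst⟩ := hy
    exact Or.inr (hR.sum_quotx_of_const hH hx hu hw hd hconst h)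
  · refine Or.inl fun i hi hiy => ?_
    by_cases hd : R.weight F (i + 1) x = 0
    · simp [hd]
    · exact (hcmp i hi hd).resolve_right fun hc => hy ⟨i, hi, hiy, hd, hc⟩

/-- Some length `m ≥ N` at which the sequence of eigenvalues increases strictly; eigenfamilies of
this length span the eigenspaces of the first `N` eigenvalues. -/
theorem exists_length (hR : R.StandingAssumptions Ω) (hH : ¬ FiniteDimensional ℝ R.H)
    (hx : x ∈ Ω) (N : ℕ) : ∃ m, N ≤ m ∧ ∀ w, IsEigenFamily (R.bForm x) (R.gForm x) m w →
      ∀ k < N, ∀ u : R.H, (∀ v, R.gForm x u v = R.eigenvalue (k + 1) x * R.bForm x u v) →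
        u = ∑ j ∈ Finset.range m, R.bForm x u (w j) • w j := by
  obtain ⟨t, hp⟩ := hR.exists_compactFormPair hx
  obtain ⟨m, hm, hmN⟩ := hp.exists_index_gap hH (minMax (R.bForm x) (R.gForm x) (N + 1))
  have hmono := (hp.spectral hH).1
  have hNm : N ≤ m := by
    by_contra hlt
    exact (hmono m N (by omega)).not_gt hm
  refine ⟨m, hNm, fun w hw k hk u hu => ?_⟩
  exact hp.eq_sum_of_eigen hH hw hu (fun i hi => (hmN i hi).trans_lt hm)
    (by rw [eigenvalue_eq]; exact (hmono k N hk.le).trans_lt hm)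

/-- Under the gap conditions, a functional of the set `C'` compares with the directional derivative
of `F(λ₁, …, λ_N)` along some sequence `x + t h`, `t ↓ 0`. -/
theorem exists_directional_compare (hR : R.StandingAssumptions Ω)
    (hH : ¬ FiniteDimensional ℝ R.H) (hx : x ∈ Ω) (hF : ContDiff ℝ 1 F) {u : ℕ → R.H}
    (hu : IsEigenFamily (R.bForm x) (R.gForm x) N u) (h : X) :
    ∃ (t : ℕ → ℝ) (L : ℝ), Tendsto t atTop (𝓝[>] 0) ∧
      Tendsto (fun n => (R.combination F (x + t n • h) - R.combination F x) / t n) atTop (𝓝 L) ∧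
      ((∀ k : ℕ, 1 ≤ k → R.weight F k x ≠ 0 → R.UpperGap F k x ∨ R.ConstOnCluster F k x) →
        (∑ i : Fin N, R.weight F (i + 1) x • R.quotx x (u i)) h ≤ L) ∧
      ((∀ k : ℕ, 1 ≤ k → R.weight F k x ≠ 0 → R.LowerGap F k x ∨ R.ConstOnCluster F k x) →
        L ≤ (∑ i : Fin N, R.weight F (i + 1) x • R.quotx x (u i)) h) := by
  obtain ⟨m, hNm, hspan⟩ := hR.exists_length hH hx N
  obtain ⟨t, w, ht, hw, hL, hord⟩ := hR.exists_directional hH hx hF hNm h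
  have hmono : ∀ {i j : ℕ}, i ≤ j → R.eigenvalue (i + 1) x ≤ R.eigenvalue (j + 1) x :=
    fun hij => hR.eigenvalue_mono hH hx hij
  -- each `𝓡_x(x,u_k)` is an average of the `𝓡_x(x,w_j)` with `j` in the same cluster
  have hav : ∀ i < N, ∃ c : ℕ → ℝ, (∀ j, 0 ≤ c j) ∧
      (∀ j < m, R.eigenvalue (j + 1) x ≠ R.eigenvalue (i + 1) x → c j = 0) ∧
      ∑ j ∈ Finset.range m, c j = 1 ∧
      R.quotx x (u i) h = ∑ j ∈ Finset.range m, c j * R.quotx x (w j) h := fun i hi => by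
    have hui : ∀ v, R.gForm x (u i) v = R.eigenvalue (i + 1) x * R.bForm x (u i) v := by
      rw [eigenvalue_eq]
      exact hu.eigen i hi
    exact hR.exists_average hx hw (fun a ha b hb hab => (hord a ha b hb hab).2) hui
      (by simpa using hu.ortho i hi i hi) (hspan w hw i hi (u i) hui)
  refine ⟨t, _, ht, hL, fun hgap => ?_, fun hgap => ?_⟩
  · refine hR.sum_weight_le hH hx hu (hw.mono hNm) fun i hi hd => ?_
    refine (hgap (i + 1) (by omega) hd).imp_left fun hup => ?_
    have hle : R.eigenvalue (i + 1) x ≤ R.eigenvalue (i + 1 + 1) x := hmono (Nat.le_succ i)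
    have hup' : R.weight F (i + 1) x *
      (R.eigenvalue (i + 1) x - R.eigenvalue (i + 1 + 1) x) < 0 := hup
    have hdpos : 0 < R.weight F (i + 1) x := by
      by_contra hneg
      exact hup'.not_ge (mul_nonneg_of_nonpos_of_nonpos (not_lt.1 hneg) (by linarith))
    have hlt : R.eigenvalue (i + 1) x < R.eigenvalue (i + 1 + 1) x := by
      refine lt_of_le_of_ne hle fun heq => hup'.ne ?_
      rw [heq, sub_self, mul_zero]
    refine mul_le_mul_of_nonneg_left ?_ hdpos.le
    obtain ⟨c, hc0, hcz, hc1, hcq⟩ := hav i hi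
    rw [hcq, ← one_mul (R.quotx x (w i) h), ← hc1, Finset.sum_mul]
    refine Finset.sum_le_sum fun j hj => ?_
    have hj' := Finset.mem_range.1 hj
    by_cases hji : R.eigenvalue (j + 1) x = R.eigenvalue (i + 1) x
    · refine mul_le_mul_of_nonneg_left ((hord j hj' i (by omega) hji).1 ?_) (hc0 j)
      by_contra hij
      have := hmono (show i + 1 ≤ j by omega)
      linarith
    · simp [hcz j hj' hji]
  · refine hR.sum_weight_le hH hx (hw.mono hNm) hu fun i hi hd => ?_
    refine (hgap (i + 1) (by omega) hd).imp_left fun hlow => ?_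
    have hkey : 0 < R.weight F (i + 1) x ∧
        ∀ j, R.eigenvalue (j + 1) x = R.eigenvalue (i + 1) x → i ≤ j := by
      rcases hlow with ⟨hi0, hpos⟩ | ⟨hi2, hlt⟩
      · exact ⟨hpos, fun j _ => by omega⟩
      · obtain ⟨i', rfl⟩ : ∃ i', i = i' + 1 := ⟨i - 1, by omega⟩
        rw [Nat.add_sub_cancel] at hlt
        have hle : R.eigenvalue (i' + 1) x ≤ R.eigenvalue (i' + 1 + 1) x := hmono (Nat.le_succ i')
        refine ⟨?_, fun j hj => ?_⟩
        · by_contra hneg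
          have := mul_nonpos_of_nonpos_of_nonneg (not_lt.1 hneg) (sub_nonneg.2 hle)
          linarith
        · by_contra hij
          have h1 := hmono (show j ≤ i' by omega)
          have h2 : R.eigenvalue (i' + 1 + 1) x = R.eigenvalue (i' + 1) x := by linarith
          rw [h2, sub_self, mul_zero, neg_zero] at hlt
          exact lt_irrefl _ hlt
    refine mul_le_mul_of_nonneg_left ?_ hkey.1.le
    obtain ⟨c, hc0, hcz, hc1, hcq⟩ := hav i hi
    rw [hcq, ← one_mul (R.quotx x (w i) h), ← hc1, Finset.sum_mul]
    refine Finset.sum_le_sum fun j hj => ?_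
    have hj' := Finset.mem_range.1 hj
    by_cases hji : R.eigenvalue (j + 1) x = R.eigenvalue (i + 1) x
    · exact mul_le_mul_of_nonneg_left ((hord i (by omega) j hj' hji.symm).1 (hkey.2 j hji)) (hc0 j)
    · simp [hcz j hj' hji]

/-- The functionals `∑ d_k 𝓡_x(x,u_k)` over the families of eigenvectors form a compact set, and
they lie in a finite-dimensional space. -/
theorem isCompact_hull (hR : R.StandingAssumptions Ω) (hH : ¬ FiniteDimensional ℝ R.H)
    (hx : x ∈ Ω) (F : (Fin N → ℝ) → ℝ) : IsCompact (R.hull F x) := by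
  obtain ⟨V, θ, hloc⟩ := hR.loc x hx
  obtain ⟨t, hp⟩ := hR.exists_compactFormPair hx
  set Φ : (Fin N → R.H) → X →L[ℝ] ℝ := fun u => ∑ i : Fin N, R.weight F (i + 1) x • R.quotx x (u i)
  have hK : IsCompact (Φ '' R.orthonormalFamilies N x) := by
    refine IsSeqCompact.isCompact fun ζ hζ => ?_
    choose us hus hζ using hζ
    obtain ⟨φ, w, hφ, hw, hconv⟩ := hR.exists_subseq_eigenFamily hH hloc
      (tendsto_const_nhds (x := x)) fun n => isEigenFamily_of_mem (hus n)
    refine ⟨_, ⟨fun i : Fin N => w i, mem_orthonormalFamilies le_rfl hw, rfl⟩, φ, hφ, ?_⟩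
    have : ζ ∘ φ = fun n => ∑ i : Fin N, R.weight F (i + 1) x • R.quotx x (us (φ n) i) :=
      funext fun n => (hζ (φ n)).symm
    rw [this]
    refine tendsto_finsetSum _ fun i _ => Tendsto.const_smul ?_ _
    simpa using hR.tendsto_quotx hH hloc (tendsto_const_nhds (x := x)) (fun _ => hx)
      (fun n => isEigenFamily_of_mem (hus (φ n))) hw i.2 (hconv i i.2)
  obtain ⟨m, hNm, hspan⟩ := hR.exists_length hH hx N
  obtain ⟨w, hw⟩ := (hp.spectral hH).2.2
  let W : Submodule ℝ (X →L[ℝ] ℝ) := Submodule.span ℝ (Set.range fun p : Fin N × Fin m × Fin m =>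
    hR.derivForm hx (R.eigenvalue (p.1 + 1) x) (w p.2.1) (w p.2.2))
  have hW : FiniteDimensional ℝ W := FiniteDimensional.span_of_finite ℝ (Set.finite_range _)
  refine hK.convexHull_of_subset_finiteDimensional (W := W) ?_
  rintro _ ⟨u, hu, rfl⟩
  have hu' := isEigenFamily_of_mem hu
  refine W.sum_mem fun k _ => W.smul_mem _ ?_
  have h1 := hR.quotx_eigenFamily hx hu' k.2
  have h2 := hspan w (hw m) k k.2 (u k) (mem_eigenspace_iff.1 (hu.1 k))
  simp only [k.2, dif_pos, Fin.eta] at h1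
  rw [h1, h2]
  simp only [map_sum, LinearMap.sum_apply, map_smul, LinearMap.smul_apply]
  refine W.sum_mem fun i hi => W.smul_mem _ (W.sum_mem fun j hj => W.smul_mem _
    (Submodule.subset_span ⟨(k, ⟨_, Finset.mem_range.1 ?_⟩, ⟨_, Finset.mem_range.1 ?_⟩), rfl⟩))
  · assumption
  · assumption

/-- Upper semicontinuity of the support function of `C'`. -/
theorem eventually_apply_le (hR : R.StandingAssumptions Ω) (hΩ : IsOpen Ω)
    (hH : ¬ FiniteDimensional ℝ R.H) (hx : x ∈ Ω) (hF : ContDiff ℝ 1 F) {h : X} {c : ℝ}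
    (hc : ∀ ξ ∈ R.hull F x, ξ h < c) :
    ∀ᶠ z in 𝓝 x, ∀ w, IsEigenFamily (R.bForm z) (R.gForm z) N w →
      (∑ i : Fin N, R.weight F (i + 1) z • R.quotx z (w i)) h ≤ c := by
  obtain ⟨V, θ, hloc⟩ := hR.loc x hx
  by_contra hne
  have hfr := (not_eventually.1 hne).and_eventually (hΩ.mem_nhds hx)
  obtain ⟨zs, hzs, hzP⟩ := exists_seq_forall_of_frequently hfr
  push Not at hzP
  choose hzP hzΩ using hzP
  choose ws hws hlt using hzP
  obtain ⟨φ, w, hφ, hw, hconv⟩ := hR.exists_subseq_eigenFamily hH hloc hzs hws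
  have hzφ := hzs.comp hφ.tendsto_atTop
  have hlim : Tendsto (fun n => (∑ i : Fin N, R.weight F (i + 1) (zs (φ n)) •
      R.quotx (zs (φ n)) (ws (φ n) i)) h) atTop
      (𝓝 ((∑ i : Fin N, R.weight F (i + 1) x • R.quotx x (w i)) h)) := by
    have hsum : Tendsto (fun n => ∑ i : Fin N, R.weight F (i + 1) (zs (φ n)) •
        R.quotx (zs (φ n)) (ws (φ n) i)) atTop
        (𝓝 (∑ i : Fin N, R.weight F (i + 1) x • R.quotx x (w i))) :=
      tendsto_finsetSum _ fun i _ => ((hR.continuousAt_weight hH hx hF i).tendsto.comp hzφ).smul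
        (hR.tendsto_quotx hH hloc hzφ (fun n => hzΩ _) (fun n => hws (φ n)) hw i.2 (hconv i i.2))
    exact ((ContinuousLinearMap.apply ℝ ℝ h).continuous.tendsto _).comp hsum
  refine (ge_of_tendsto' hlim fun n => (hlt (φ n)).le).not_gt (hc _ (subset_convexHull ℝ _ ?_))
  exact ⟨fun i : Fin N => w i, mem_orthonormalFamilies le_rfl hw, rfl⟩

theorem clarkeSubdiff_subset_hull (hR : R.StandingAssumptions Ω) (hΩ : IsOpen Ω)
    (hH : ¬ FiniteDimensional ℝ R.H) (hx : x ∈ Ω) (hF : ContDiff ℝ 1 F) :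
    clarkeSubdiff (R.combination F) x ⊆ R.hull F x := by
  intro ζ hζ
  by_contra hζh
  obtain ⟨h, c, hlt, hcζ⟩ := exists_eval_separation (hR.isCompact_hull hH hx F)
    (convex_convexHull ℝ _) hζh
  obtain ⟨c', hcc', hc'ζ⟩ := exists_between hcζ
  have hup : clarkeUpper (R.combination F) x h ≤ c' := by
    refine clarkeUpper_le hcc' ?_ ?_
    · filter_upwards [hΩ.mem_nhds hx] with z hz using hR.continuousAt_combination hH hz hF
    · filter_upwards [hΩ.mem_nhds hx, hR.eventually_apply_le hΩ hH hx hF hlt] with z hz hzc r hr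
      obtain ⟨t, w, ht, hw, hL, -⟩ := hR.exists_directional hH hz hF le_rfl h
      exact ht.frequently
        (hL.eventually (gt_mem_nhds ((hzc w hw).trans_lt hr))).frequently
  have := (hζ h).trans hup
  rw [EReal.coe_le_coe_iff] at this
  linarith

theorem hull_subset_of_upperGap (hR : R.StandingAssumptions Ω)
    (hH : ¬ FiniteDimensional ℝ R.H) (hx : x ∈ Ω) (hF : ContDiff ℝ 1 F)
    (hgap : ∀ k : ℕ, 1 ≤ k → R.weight F k x ≠ 0 → R.UpperGap F k x ∨ R.ConstOnCluster F k x) :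
    R.hull F x ⊆ clarkeSubdiff (R.combination F) x := by
  refine convexHull_min ?_ (convex_clarkeSubdiff _ _)
  rintro _ ⟨u, hu, rfl⟩ h
  obtain ⟨t, L, ht, hL, hle, -⟩ :=
    hR.exists_directional_compare hH hx hF (isEigenFamily_of_mem hu) h
  have hle := hle hgap
  simp only [Fin.is_lt, dif_pos, Fin.eta] at hle
  exact (EReal.coe_le_coe_iff.2 hle).trans (le_clarkeUpper ht hL)

theorem hull_subset_of_lowerGap (hR : R.StandingAssumptions Ω)
    (hH : ¬ FiniteDimensional ℝ R.H) (hx : x ∈ Ω) (hF : ContDiff ℝ 1 F)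
    (hgap : ∀ k : ℕ, 1 ≤ k → R.weight F k x ≠ 0 → R.LowerGap F k x ∨ R.ConstOnCluster F k x) :
    R.hull F x ⊆ clarkeSubdiff (R.combination F) x := by
  refine convexHull_min ?_ (convex_clarkeSubdiff _ _)
  rw [← clarkeSuperdiff_eq_clarkeSubdiff]
  rintro _ ⟨u, hu, rfl⟩ h
  obtain ⟨t, L, ht, hL, -, hle⟩ :=
    hR.exists_directional_compare hH hx hF (isEigenFamily_of_mem hu) h
  have hle := hle hgap
  simp only [Fin.is_lt, dif_pos, Fin.eta] at hle
  exact (clarkeLower_le ht hL).trans (EReal.coe_le_coe_iff.2 hle)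

/-- If the weights are constant on the clusters, `C'` is a singleton and its element is the Fréchet
derivative. -/
theorem exists_hasFDerivAt (hR : R.StandingAssumptions Ω) (hΩ : IsOpen Ω)
    (hH : ¬ FiniteDimensional ℝ R.H) (hx : x ∈ Ω) (hF : ContDiff ℝ 1 F)
    (hconst : ∀ k : ℕ, 1 ≤ k → R.ConstOnCluster F k x) :
    ∃ ζ : X →L[ℝ] ℝ, R.hull F x = {ζ} ∧ HasFDerivAt (R.combination F) ζ x := by
  obtain ⟨V, θ, hloc⟩ := hR.loc x hx
  obtain ⟨t, hp⟩ := hR.exists_compactFormPair hx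
  obtain ⟨w, hw⟩ := (hp.spectral hH).2.2
  have heq : ∀ u v, IsEigenFamily (R.bForm x) (R.gForm x) N u →
      IsEigenFamily (R.bForm x) (R.gForm x) N v →
      ∑ i : Fin N, R.weight F (i + 1) x • R.quotx x (u i) =
        ∑ i : Fin N, R.weight F (i + 1) x • R.quotx x (v i) := fun u v hu hv => by
    ext h
    exact le_antisymm
      (hR.sum_weight_le hH hx hu hv fun i _ _ => Or.inr (hconst _ (by omega)))
      (hR.sum_weight_le hH hx hv hu fun i _ _ => Or.inr (hconst _ (by omega)))
  refine ⟨∑ i : Fin N, R.weight F (i + 1) x • R.quotx x (w i), ?_, ?_⟩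
  · rw [hull, ← convexHull_singleton (𝕜 := ℝ)]
    congr 1
    refine Set.eq_singleton_iff_unique_mem.2
      ⟨⟨fun i : Fin N => w i, mem_orthonormalFamilies le_rfl (hw N), rfl⟩, ?_⟩
    rintro _ ⟨u, hu, rfl⟩
    simpa using heq _ w (isEigenFamily_of_mem hu) (hw N)
  · refine .of_isLittleO (Asymptotics.isLittleO_iff.2 fun c hc => ?_)
    by_contra hne
    obtain ⟨zs, hzs, hzP⟩ := exists_seq_forall_of_frequently
      ((not_eventually.1 hne).and_eventually (hΩ.mem_nhds hx))
    choose hzP hzΩ using hzP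
    have hfam : ∀ n, ∃ v, IsEigenFamily (R.bForm (zs n)) (R.gForm (zs n)) N v := fun n => by
      obtain ⟨t, hp⟩ := hR.exists_compactFormPair (hzΩ n)
      obtain ⟨v, hv⟩ := (hp.spectral hH).2.2
      exact ⟨v, hv N⟩
    choose ws hws using hfam
    obtain ⟨φ, v, hφ, hv, hconv⟩ := hR.exists_subseq_eigenFamily hH hloc hzs hws
    have hexp := hR.combination_expansion hH hloc hF (hzs.comp hφ.tendsto_atTop)
      (fun n => hws (φ n)) hv hconv
    rw [heq v w hv (hw N)] at hexp
    obtain ⟨n, hn⟩ := (Asymptotics.isLittleO_iff.1 hexp hc).exists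
    exact hzP (φ n) hn

end StandingAssumptions

end RayleighPair

theorem proposition3p11
    {X Y : Type*} [NormedAddCommGroup X] [NormedSpace ℝ X] [CompleteSpace X]
    [AddCommGroup Y] [Module ℝ Y]
    (Ω : Set X) (hΩ : IsOpen Ω)
    (R : RayleighPair X Y) (hR : R.StandingAssumptions Ω)
    (hH : ¬ FiniteDimensional ℝ R.H)
    (N : ℕ) (hN : 1 ≤ N) (F : (Fin N → ℝ) → ℝ) (hF : ContDiff ℝ 1 F)
    (x : X) (hx : x ∈ Ω) :
    (clarkeSubdiff (R.combination F) x ⊆ R.hull F x ∧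
      clarkeSuperdiff (R.combination F) x ⊆ R.hull F x) ∧
    (R.eigenvalue N x < R.eigenvalue (N + 1) x →
      (∀ k : ℕ, 1 ≤ k → R.ConstOnCluster F k x) →
      clarkeSubdiff (R.combination F) x ∪ clarkeSuperdiff (R.combination F) x = R.hull F x ∧
      (∃ ζ : X →L[ℝ] ℝ, R.hull F x = {ζ}) ∧
      DifferentiableAt ℝ (R.combination F) x) ∧
    ((∀ k : ℕ, 1 ≤ k → R.weight F k x ≠ 0 → R.UpperGap F k x ∨ R.ConstOnCluster F k x) →
      clarkeSubdiff (R.combination F) x = R.hull F x ∧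
      clarkeSuperdiff (R.combination F) x = R.hull F x) ∧
    ((∀ k : ℕ, 1 ≤ k → R.weight F k x ≠ 0 → R.LowerGap F k x ∨ R.ConstOnCluster F k x) →
      clarkeSubdiff (R.combination F) x = R.hull F x ∧
      clarkeSuperdiff (R.combination F) x = R.hull F x) := by
  have hsub := hR.clarkeSubdiff_subset_hull hΩ hH hx hF
  rw [clarkeSuperdiff_eq_clarkeSubdiff, Set.union_self]
  refine ⟨⟨hsub, hsub⟩, fun _ hconst => ?_, fun hgap => ?_, fun hgap => ?_⟩
  · obtain ⟨ζ, hζ, hd⟩ := hR.exists_hasFDerivAt hΩ hH hx hF hconst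
    exact ⟨hsub.antisymm (hR.hull_subset_of_upperGap hH hx hF fun k hk _ => Or.inr (hconst k hk)),
      ⟨ζ, hζ⟩, hd.differentiableAt⟩
  · have := hsub.antisymm (hR.hull_subset_of_upperGap hH hx hF hgap)
    exact ⟨this, this⟩
  · have := hsub.antisymm (hR.hull_subset_of_lowerGap hH hx hF hgap)
    exact ⟨this, this⟩

end
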